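/- Let $\mathcal{A}$ be an abelian category with derived category $\mathcal{D}=\mathcal{D}(\mathcal{A})$, suspension $\Sigma$, and standard t-structure with aisle $\mathcal{D}^{\le 0}$ and coaisle $\mathcal{D}^{\ge 0}$. Let $\mathbf{u}=(\mathcal{T},\mathcal{F})$ be a torsion pair in $\mathcal{A}$: $\mathcal{T},\mathcal{F}$ are full subcategories closed under isomorphisms, $\mathrm{Hom}(T,F)=0$ for $T\in\mathcal{T}$, $F\in\mathcal{F}$, and every $X\in\mathcal{A}$ admits a short exact sequence $0\to T\to X\to F\to 0$ with $T\in\mathcal{T}$, $F\in\mathcal{F}$. For classes $\mathcal{P},\mathcal{Q}$ of objects of $\mathcal{D}$ write $\mathcal{P}\star\mathcal{Q}$ for the class of all $X$ that admit a distinguished triangle $P\to X\to Q\to\Sigma P$ with $P\in\mathcal{P}$, $Q\in\mathcal{Q}$. Let $\mathbf{x}=(\mathcal{U},\mathcal{W})=(\Sigma\mathcal{D}^{\le 0}\star\mathcal{T},\ \Sigma\mathcal{F}\star\mathcal{D}^{\ge 0})$ be the HRS-tilted t-structure in $\mathcal{D}$, $\mathcal{H}=\mathcal{U}\cap\mathcal{W}$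 its heart, and $\mathcal{C}=\mathcal{H}\star\Sigma^{-1}\mathcal{H}$. The subcategory $\mathcal{C}$ is extension-closed in $\mathcal{D}$ and is regarded as an extriangulated category with $\mathbb{E}(Z,X)=\mathrm{Hom}_{\mathcal{D}}(Z,\Sigma X)$, where $\eta\in\mathbb{E}(Z,X)$ is realized by the sequences $X\to Y\to Z$ in $\mathcal{C}$ such that $X\to Y\to Z\xrightarrow{\eta}\Sigma X$ is a distinguished triangle. Say that $\mathbf{x}$ is smashing if $\mathcal{W}$ is closed under coproducts in $\mathcal{D}$, and co-smashing if $\mathcal{U}$ is closed under products in $\mathcal{D}$; that $\mathbf{u}$ is smashing if $\mathcal{F}$ is closed under coproducts in $\mathcal{A}$, and co-smashing if $\mathcal{T}$ is closed under products in $\mathcal{A}$. An extriangulated category $(\mathcal{C},\mathbb{E},\mathfrak{s})$ is AET3.5 if for every set $I\neq\emptyset$ all coproducts indexed by $I$ exist in $\mathcal{C}$ and there is a homomorphism of abelian groups $\Gamma:\prod_{i\in I}\mathbb{E}(B_i,A)\to\mathbb{E}(\coprod_{i\in I}B_i,A^{(I)})$, natural in $A\in\mathcal{C}$ and in the family $(B_i)_{i\in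 I}$ of objects of $\mathcal{C}$, such that whenever $\eta_i$ is realized by $A\xrightarrow{f_i}E_i\xrightarrow{g_i}B_i$ for all $i\in I$, $\Gamma((\eta_i)_i)$ is realized by $A^{(I)}\xrightarrow{\coprod f_i}\coprod E_i\xrightarrow{\coprod g_i}\coprod B_i$. It is AET4 if moreover $\Gamma$ can be chosen such that $\mathbb{E}(\mu_i^B,A^{(I)})(\Gamma((\eta_j)_j))=\mathbb{E}(B_i,\mu_i^A)(\eta_i)$ for all $(\eta_j)_j$ and all $i\in I$, where $\mu_i^B:B_i\to\coprod_j B_j$ and $\mu_i^A:A\to A^{(I)}$ are the canonical inclusions. It is AET3.5* (resp. AET4*) if the opposite extriangulated category is AET3.5 (resp. AET4). (1) If $\mathcal{A}$ is AB4 (coproducts indexed by arbitrary sets exist and are exact), then the following statements are equivalent: (a) $\mathbf{x}$ is smashing; (b) $\mathbf{u}$ is smashing; (c) $\mathcal{C}$ is AET4; (d) $\mathcal{C}$ is AET3.5. (2) If $\mathcal{A}$ is AB4* (products indexed by arbitrary sets exist and are exact), then the following statements are equivalent: (a) $\mathbf{x}$ is co-smashing; (b) $\mathbf{u}$ is co-smashing;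 (c) $\mathcal{C}$ is AET4*; (d) $\mathcal{C}$ is AET3.5*. -/

import Mathlib

open CategoryTheory CategoryTheory.Category CategoryTheory.Limits CategoryTheory.Pretriangulated
  CategoryTheory.Triangulated

universe t w v u

/-! ### Extriangulated categories -/

/-- The direct sum `x ⊕ x' : a.pt ⟶ b.pt` of two morphisms, for arbitrary biproducts. -/
def CategoryTheory.Limits.BinaryBicone.sumMap {C : Type u} [Category.{v} C] [Preadditive C]
    {X X' Y Y' : C} (a : BinaryBicone X X') (b : BinaryBicone Y Y') (x : X ⟶ Y) (x' : X' ⟶ Y') :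
    a.pt ⟶ b.pt :=
  a.fst ≫ x ≫ b.inl + a.snd ≫ x' ≫ b.inr

/-- An extriangulated structure (in the sense of Nakaoka and Palu) on an additive category `C`:
an additive bifunctor `Ext = 𝔼 : Cᵒᵖ × C ⥤ Ab` with an additive realization `𝔰`, subject to the
axioms (ET1), (ET2), (ET3), (ET3)ᵒᵖ, (ET4), (ET4)ᵒᵖ.

`pull f η` is `η · f = 𝔼(f, X)(η)` and `push g η` is `g · η = 𝔼(Z, g)(η)`.
`Realizes η f g` says that the equivalence class `𝔰(η)` is the class of the
sequence `X --f--> Y --g--> Z`. -/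
structure ExtriangulatedStructure (C : Type u) [Category.{v} C] [Preadditive C] [HasZeroObject C]
    [HasBinaryBiproducts C] where
  /-- The group `𝔼(Z, X)` of extensions. -/
  Ext : C → C → Type w
  [addCommGroup (Z X : C) : AddCommGroup (Ext Z X)]
  /-- The contravariant action `η ↦ η · f`. -/
  pull {Z' Z X : C} (f : Z' ⟶ Z) : Ext Z X →+ Ext Z' X
  /-- The covariant action `η ↦ g · η`. -/
  push {Z X X' : C} (g : X ⟶ X') : Ext Z X →+ Ext Z X'
  pull_id {Z X : C} (η : Ext Z X) : pull (𝟙 Z) η = η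
  pull_comp {Z'' Z' Z X : C} (f' : Z'' ⟶ Z') (f : Z' ⟶ Z) (η : Ext Z X) :
    pull (f' ≫ f) η = pull f' (pull f η)
  push_id {Z X : C} (η : Ext Z X) : push (𝟙 X) η = η
  push_comp {Z X X' X'' : C} (g : X ⟶ X') (g' : X' ⟶ X'') (η : Ext Z X) :
    push (g ≫ g') η = push g' (push g η)
  push_pull {Z' Z X X' : C} (f : Z' ⟶ Z) (g : X ⟶ X') (η : Ext Z X) :
    push g (pull f η) = pull f (push g η)
  pull_add {Z' Z X : C} (f f' : Z' ⟶ Z) (η : Ext Z X) : pull (f + f') η = pull f η + pull f' η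
  push_add {Z X X' : C} (g g' : X ⟶ X') (η : Ext Z X) : push (g + g') η = push g η + push g' η
  /-- The sequence `X --f--> Y --g--> Z` belongs to the equivalence class `𝔰(η)`. -/
  Realizes {X Y Z : C} (η : Ext Z X) (f : X ⟶ Y) (g : Y ⟶ Z) : Prop
  exists_realizes {X Z : C} (η : Ext Z X) :
    ∃ (Y : C) (f : X ⟶ Y) (g : Y ⟶ Z), Realizes η f g
  realizes_iff {X Y Y' Z : C} {η : Ext Z X} {f : X ⟶ Y} {g : Y ⟶ Z} (h : Realizes η f g)
    (f' : X ⟶ Y') (g' : Y' ⟶ Z) :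
    Realizes η f' g' ↔ ∃ e : Y ≅ Y', f ≫ e.hom = f' ∧ e.hom ≫ g' = g
  /-- A morphism of extensions `(a, c) : η ⟶ η'` is realized by a morphism of sequences. -/
  exists_hom₂ {X Y Z X' Y' Z' : C} {η : Ext Z X} {f : X ⟶ Y} {g : Y ⟶ Z} {η' : Ext Z' X'}
    {f' : X' ⟶ Y'} {g' : Y' ⟶ Z'} (h : Realizes η f g) (h' : Realizes η' f' g')
    (a : X ⟶ X') (c : Z ⟶ Z') (hac : push a η = pull c η') :
    ∃ b : Y ⟶ Y', f ≫ b = a ≫ f' ∧ g ≫ c = b ≫ g'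
  /-- The zero extension is realized by the split sequence. -/
  realizes_zero {X Z : C} (b : BinaryBicone X Z) (hb : b.IsBilimit) :
    Realizes (0 : Ext Z X) b.inl b.snd
  /-- The direct sum of two extensions is realized by the direct sum of the realizations. -/
  realizes_sum {X Y Z X' Y' Z' : C} {η : Ext Z X} {f : X ⟶ Y} {g : Y ⟶ Z} {η' : Ext Z' X'}
    {f' : X' ⟶ Y'} {g' : Y' ⟶ Z'} (h : Realizes η f g) (h' : Realizes η' f' g')
    (a : BinaryBicone X X') (ha : a.IsBilimit) (b : BinaryBicone Y Y') (hb : b.IsBilimit)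
    (c : BinaryBicone Z Z') (hc : c.IsBilimit) :
    Realizes (push a.inl (pull c.fst η) + push a.inr (pull c.snd η') : Ext c.pt a.pt)
      (a.sumMap b f f') (b.sumMap c g g')
  /-- (ET3) -/
  exists_hom₃ {X Y Z X' Y' Z' : C} {η : Ext Z X} {f : X ⟶ Y} {g : Y ⟶ Z} {η' : Ext Z' X'}
    {f' : X' ⟶ Y'} {g' : Y' ⟶ Z'} (h : Realizes η f g) (h' : Realizes η' f' g')
    (a : X ⟶ X') (b : Y ⟶ Y') (hab : f ≫ b = a ≫ f') :
    ∃ c : Z ⟶ Z', g ≫ c = b ≫ g' ∧ push a η = pull c η'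
  /-- (ET3)ᵒᵖ -/
  exists_hom₁ {X Y Z X' Y' Z' : C} {η : Ext Z X} {f : X ⟶ Y} {g : Y ⟶ Z} {η' : Ext Z' X'}
    {f' : X' ⟶ Y'} {g' : Y' ⟶ Z'} (h : Realizes η f g) (h' : Realizes η' f' g')
    (b : Y ⟶ Y') (c : Z ⟶ Z') (hbc : g ≫ c = b ≫ g') :
    ∃ a : X ⟶ X', f ≫ b = a ≫ f' ∧ push a η = pull c η'
  /-- (ET4) -/
  exists_octahedron {A B C' D F : C} {f : A ⟶ B} {f' : B ⟶ D} {δ : Ext D A}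
    {g : B ⟶ C'} {g' : C' ⟶ F} {δ' : Ext F B}
    (h : Realizes δ f f') (h' : Realizes δ' g g') :
    ∃ (E : C) (k : C' ⟶ E) (d : D ⟶ E) (e : E ⟶ F) (δ'' : Ext E A),
      Realizes δ'' (f ≫ g) k ∧ Realizes (push f' δ') d e ∧
      g ≫ k = f' ≫ d ∧ k ≫ e = g' ∧ pull d δ'' = δ ∧ push f δ'' = pull e δ'
  /-- (ET4)ᵒᵖ -/
  exists_octahedron_op {A B C' D F : C} {f' : D ⟶ A} {f : A ⟶ B} {δ : Ext B D}
    {g' : F ⟶ B} {g : B ⟶ C'} {δ' : Ext C' F}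
    (h : Realizes δ f' f) (h' : Realizes δ' g' g) :
    ∃ (E : C) (d : D ⟶ E) (e : E ⟶ F) (k : E ⟶ A) (δ'' : Ext C' E),
      Realizes δ'' k (f ≫ g) ∧ Realizes (pull g' δ) d e ∧
      d ≫ k = f' ∧ k ≫ f = e ≫ g' ∧ push e δ'' = δ' ∧ push d δ = pull g δ''

namespace ExtriangulatedStructure

attribute [instance] addCommGroup

section Opposite

variable {C : Type u} [Category.{v} C] [Preadditive C]

/-- The binary bicone in `C` corresponding to a binary bicone in `Cᵒᵖ`. -/
def unopBicone {X X' : Cᵒᵖ} (a : BinaryBicone X X') : BinaryBicone X.unop X'.unop where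
  pt := a.pt.unop
  fst := a.inl.unop
  snd := a.inr.unop
  inl := a.fst.unop
  inr := a.snd.unop
  inl_fst := by rw [← unop_comp, a.inl_fst, unop_id]
  inl_snd := by rw [← unop_comp, a.inr_fst, unop_zero]
  inr_fst := by rw [← unop_comp, a.inl_snd, unop_zero]
  inr_snd := by rw [← unop_comp, a.inr_snd, unop_id]

lemma unopBicone_total {X X' : Cᵒᵖ} {a : BinaryBicone X X'} (ha : a.IsBilimit) :
    (unopBicone a).fst ≫ (unopBicone a).inl + (unopBicone a).snd ≫ (unopBicone a).inr =
      𝟙 (unopBicone a).pt := by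
  have h := congrArg Quiver.Hom.unop (IsBilimit.binary_total ha)
  rwa [unop_add, unop_comp, unop_comp, unop_id] at h

variable [HasZeroObject C] [HasBinaryBiproducts C]

/-- The opposite extriangulated structure on `Cᵒᵖ`: `𝔼ᵒᵖ(Z, X) = 𝔼(X, Z)`, and the realizations
are the opposite sequences. -/
noncomputable def op (S : ExtriangulatedStructure.{w} C) : ExtriangulatedStructure.{w} Cᵒᵖ where
  Ext Z X := S.Ext X.unop Z.unop
  addCommGroup Z X := S.addCommGroup X.unop Z.unop
  pull f := S.push f.unop
  push g := S.pull g.unop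
  pull_id η := S.push_id η
  pull_comp f' f η := S.push_comp f.unop f'.unop η
  push_id η := S.pull_id η
  push_comp g g' η := S.pull_comp g'.unop g.unop η
  push_pull f g η := (S.push_pull g.unop f.unop η).symm
  pull_add f f' η := S.push_add f.unop f'.unop η
  push_add g g' η := S.pull_add g.unop g'.unop η
  Realizes η f g := S.Realizes η g.unop f.unop
  exists_realizes η := by
    obtain ⟨Y, f, g, h⟩ := S.exists_realizes η
    exact ⟨.op Y, g.op, f.op, h⟩
  realizes_iff h f' g' := by
    refine (S.realizes_iff h g'.unop f'.unop).trans ⟨?_, ?_⟩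
    · rintro ⟨e, h₁, h₂⟩
      refine ⟨e.symm.op, ?_, ?_⟩
      · apply Quiver.Hom.unop_inj
        simp [← h₂]
      · apply Quiver.Hom.unop_inj
        simp [← h₁]
    · rintro ⟨e, h₁, h₂⟩
      refine ⟨e.symm.unop, ?_, ?_⟩
      · simp [← h₂]
      · simp [← h₁]
  exists_hom₂ h h' a c hac := by
    obtain ⟨b, h₁, h₂⟩ := S.exists_hom₂ h' h c.unop a.unop hac.symm
    exact ⟨b.op, Quiver.Hom.unop_inj h₂.symm, Quiver.Hom.unop_inj h₁.symm⟩
  realizes_zero b hb := by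
    have total := unopBicone_total hb
    rw [add_comm] at total
    exact S.realizes_zero
      { pt := (unopBicone b).pt
        fst := (unopBicone b).snd
        snd := (unopBicone b).fst
        inl := (unopBicone b).inr
        inr := (unopBicone b).inl
        inl_fst := (unopBicone b).inr_snd
        inl_snd := (unopBicone b).inr_fst
        inr_fst := (unopBicone b).inl_snd
        inr_snd := (unopBicone b).inl_fst }
      (isBinaryBilimitOfTotal _ total)
  realizes_sum {X Y Z X' Y' Z' η f g η' f' g'} h h' a ha b hb c hc := by
    have key := S.realizes_sum h h'
      (unopBicone c) (isBinaryBilimitOfTotal _ (unopBicone_total hc))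
      (unopBicone b) (isBinaryBilimitOfTotal _ (unopBicone_total hb))
      (unopBicone a) (isBinaryBilimitOfTotal _ (unopBicone_total ha))
    have h₁ : (unopBicone c).sumMap (unopBicone b) g.unop g'.unop =
        (b.sumMap c g g').unop := by
      simp [BinaryBicone.sumMap, unopBicone]
      rfl
    have h₂ : (unopBicone b).sumMap (unopBicone a) f.unop f'.unop =
        (a.sumMap b f f').unop := by
      simp [BinaryBicone.sumMap, unopBicone]
      rfl
    rw [h₁, h₂, S.push_pull, S.push_pull] at key
    exact key
  exists_hom₃ h h' a b hab := by
    obtain ⟨c, h₁, h₂⟩ := S.exists_hom₁ h' h b.unop a.unop (congrArg Quiver.Hom.unop hab).symm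
    exact ⟨c.op, Quiver.Hom.unop_inj h₁.symm, h₂.symm⟩
  exists_hom₁ h h' b c hbc := by
    obtain ⟨a, h₁, h₂⟩ := S.exists_hom₃ h' h c.unop b.unop (congrArg Quiver.Hom.unop hbc).symm
    exact ⟨a.op, Quiver.Hom.unop_inj h₁.symm, h₂.symm⟩
  exists_octahedron h h' := by
    obtain ⟨E, d, e, k, δ'', h₁, h₂, h₃, h₄, h₅, h₆⟩ := S.exists_octahedron_op h' h
    exact ⟨.op E, k.op, e.op, d.op, δ'', h₁, h₂, Quiver.Hom.unop_inj h₄, Quiver.Hom.unop_inj h₃,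
      h₅, h₆.symm⟩
  exists_octahedron_op h h' := by
    obtain ⟨E, k, d, e, δ'', h₁, h₂, h₃, h₄, h₅, h₆⟩ := S.exists_octahedron h' h
    exact ⟨.op E, e.op, d.op, k.op, δ'', h₁, h₂, Quiver.Hom.unop_inj h₄, Quiver.Hom.unop_inj h₃,
      h₅, h₆.symm⟩

end Opposite
end ExtriangulatedStructure

namespace ExtriangulatedStructure

section AET

variable {C : Type u} [Category.{v} C] [Preadditive C] [HasZeroObject C] [HasBinaryBiproducts C]
  (S : ExtriangulatedStructure.{w} C)

/-- For a set `I` such that `C` has coproducts indexed by `I`, with constant functor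
`T : C ⥤ C^I`: a natural transformation
`Γ : ∏ᵢ 𝔼(Bᵢ, A) ⟶ 𝔼(∐ᵢ Bᵢ, A^(I))` of functors to abelian groups, natural in `(Bᵢ)ᵢ : C^I` and
in `A : C`, which makes the functor `∐ : C^I ⥤ C` a `(1, T)`-extriangulated functor: if `ηᵢ` is
realized by `A ⟶ Eᵢ ⟶ Bᵢ` for all `i`, then `Γ η` is realized by `A^(I) ⟶ ∐ᵢ Eᵢ ⟶ ∐ᵢ Bᵢ`. -/
structure CoproductExtension (I : Type t) [HasCoproductsOfShape I C] where
  /-- The components of `Γ`. -/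
  Γ (B : I → C) (A : C) : (∀ i, S.Ext (B i) A) →+ S.Ext (∐ B) (∐ fun _ : I ↦ A)
  pull_Γ {B B' : I → C} (f : ∀ i, B' i ⟶ B i) {A : C} (η : ∀ i, S.Ext (B i) A) :
    Γ B' A (fun i ↦ S.pull (f i) (η i)) = S.pull (Limits.Sigma.map f) (Γ B A η)
  push_Γ {B : I → C} {A A' : C} (g : A ⟶ A') (η : ∀ i, S.Ext (B i) A) :
    Γ B A' (fun i ↦ S.push g (η i)) = S.push (Limits.Sigma.map fun _ ↦ g) (Γ B A η)
  realizes_Γ {B E : I → C} {A : C} (η : ∀ i, S.Ext (B i) A) (f : ∀ i, A ⟶ E i)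
    (g : ∀ i, E i ⟶ B i) (h : ∀ i, S.Realizes (η i) (f i) (g i)) :
    S.Realizes (Γ B A η) (Limits.Sigma.map f) (Limits.Sigma.map g)

/-- The coproduct inclusions are extriangulated: `Γ(η) · μᵢ = μᵢ · ηᵢ` for all `i`. -/
def CoproductExtension.InclusionsExtriangulated {S : ExtriangulatedStructure.{w} C} {I : Type t}
    [HasCoproductsOfShape I C] (G : S.CoproductExtension I) : Prop :=
  ∀ (B : I → C) (A : C) (η : ∀ i, S.Ext (B i) A) (i : I),
    S.pull (Limits.Sigma.ι B i) (G.Γ B A η) = S.push (Limits.Sigma.ι (fun _ : I ↦ A) i) (η i)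

/-- `C` is AET3.5: for every nonempty set `I` the coproducts indexed by `I` exist, and the
coproduct functor `C^I ⥤ C` is `(1, T)`-extriangulated. -/
def IsAET35 : Prop :=
  ∀ (I : Type t) [Nonempty I], ∃ _ : HasCoproductsOfShape I C, Nonempty (S.CoproductExtension I)

/-- `C` is AET4: for every nonempty set `I` the coproducts indexed by `I` exist, the
coproduct functor `C^I ⥤ C` is `(1, T)`-extriangulated, and so are the coproduct inclusions. -/
def IsAET4 : Prop :=
  ∀ (I : Type t) [Nonempty I], ∃ _ : HasCoproductsOfShape I C,
    ∃ G : S.CoproductExtension I, G.InclusionsExtriangulated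

/-- `C` is AET3.5* if `Cᵒᵖ` is AET3.5. -/
def IsAET35Star : Prop := IsAET35.{t} S.op

/-- `C` is AET4* if `Cᵒᵖ` is AET4. -/
def IsAET4Star : Prop := IsAET4.{t} S.op

end AET

/-! ### Extension-closed subcategories of triangulated categories -/

section Subcategory

variable {D : Type u} [Category.{v} D] [Preadditive D]

lemma isIso_pi_lift_bool (T : Bool → D) [HasProduct T] (a : BinaryBicone (T true) (T false))
    (ha : a.fst ≫ a.inl + a.snd ≫ a.inr = 𝟙 a.pt) (p : ∀ j, a.pt ⟶ T j)
    (h₁ : p true = a.fst) (h₂ : p false = a.snd) : IsIso (Pi.lift p) := by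
  refine ⟨Pi.π T true ≫ a.inl + Pi.π T false ≫ a.inr, ?_, ?_⟩
  · simp [h₁, h₂, ha]
  · refine Limits.Pi.hom_ext _ _ ?_
    rintro (_ | _) <;> simp [h₁, h₂]

/-- The image in `D` of a binary bicone in a full subcategory. -/
def ambientBicone {P : ObjectProperty D} {X X' : P.FullSubcategory} (a : BinaryBicone X X') :
    BinaryBicone X.obj X'.obj where
  pt := a.pt.obj
  fst := a.fst.hom
  snd := a.snd.hom
  inl := a.inl.hom
  inr := a.inr.hom
  inl_fst := congrArg InducedCategory.Hom.hom a.inl_fst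
  inl_snd := congrArg InducedCategory.Hom.hom a.inl_snd
  inr_fst := congrArg InducedCategory.Hom.hom a.inr_fst
  inr_snd := congrArg InducedCategory.Hom.hom a.inr_snd

lemma ambientBicone_total {P : ObjectProperty D} {X X' : P.FullSubcategory}
    {a : BinaryBicone X X'} (ha : a.IsBilimit) :
    (ambientBicone a).fst ≫ (ambientBicone a).inl + (ambientBicone a).snd ≫ (ambientBicone a).inr =
      𝟙 (ambientBicone a).pt :=
  congrArg (fun f : a.pt ⟶ a.pt ↦ f.hom) (IsBilimit.binary_total ha)

variable [HasZeroObject D] [HasShift D ℤ] [∀ n : ℤ, (shiftFunctor D n).Additive]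
  [Pretriangulated D]

instance hasBinaryBiproducts_fullSubcategory (P : ObjectProperty D) [P.IsClosedUnderIsomorphisms]
    [P.IsTriangulatedClosed₂] : HasBinaryBiproducts P.FullSubcategory where
  has_binary_biproduct X Y := by
    have h : P (X.obj ⊞ Y.obj) := P.ext_of_isTriangulatedClosed₂ _
      (binaryBiproductTriangle_distinguished X.obj Y.obj) X.property Y.property
    let b : BinaryBicone X Y :=
      { pt := ⟨X.obj ⊞ Y.obj, h⟩
        fst := P.homMk biprod.fst
        snd := P.homMk biprod.snd
        inl := P.homMk biprod.inl
        inr := P.homMk biprod.inr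
        inl_fst := by ext; exact biprod.inl_fst
        inl_snd := by ext; exact biprod.inl_snd
        inr_fst := by ext; exact biprod.inr_fst
        inr_snd := by ext; exact biprod.inr_snd }
    have hb : b.fst ≫ b.inl + b.snd ≫ b.inr = 𝟙 b.pt :=
      InducedCategory.hom_ext (biprod.total (X := X.obj) (Y := Y.obj))
    exact hasBinaryBiproduct_of_total b hb

lemma distinguished_of_bilimit {X Z : D} (b : BinaryBicone X Z)
    (hb : b.fst ≫ b.inl + b.snd ≫ b.inr = 𝟙 b.pt) :
    Triangle.mk b.inl b.snd (0 : Z ⟶ X⟦(1 : ℤ)⟧) ∈ distTriang D := by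
  let e : b.pt ≅ X ⊞ Z :=
    { hom := biprod.lift b.fst b.snd
      inv := biprod.desc b.inl b.inr
      hom_inv_id := by simp [biprod.lift_desc, hb]
      inv_hom_id := by ext <;> simp }
  have h₁ : b.inl ≫ e.hom = 𝟙 X ≫ biprod.inl := by dsimp [e]; ext <;> simp
  have h₂ : b.snd ≫ 𝟙 Z = e.hom ≫ biprod.snd := by simp [e]
  have h₃ : (0 : Z ⟶ X⟦(1 : ℤ)⟧) ≫ (𝟙 X)⟦(1 : ℤ)⟧' = 𝟙 Z ≫ 0 := by simp
  exact isomorphic_distinguished _ (binaryBiproductTriangle_distinguished X Z) _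
    (Triangle.isoMk _ _ (Iso.refl X) e (Iso.refl Z) h₁ h₂ h₃)

lemma distinguished_sum {X Y Z X' Y' Z' : D} {f : X ⟶ Y} {g : Y ⟶ Z} {η : Z ⟶ X⟦(1 : ℤ)⟧}
    {f' : X' ⟶ Y'} {g' : Y' ⟶ Z'} {η' : Z' ⟶ X'⟦(1 : ℤ)⟧}
    (h : Triangle.mk f g η ∈ distTriang D) (h' : Triangle.mk f' g' η' ∈ distTriang D)
    (a : BinaryBicone X X') (ha : a.fst ≫ a.inl + a.snd ≫ a.inr = 𝟙 a.pt)
    (b : BinaryBicone Y Y') (hb : b.fst ≫ b.inl + b.snd ≫ b.inr = 𝟙 b.pt)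
    (c : BinaryBicone Z Z') (hc : c.fst ≫ c.inl + c.snd ≫ c.inr = 𝟙 c.pt) :
    Triangle.mk (a.sumMap b f f') (b.sumMap c g g')
      ((c.fst ≫ η) ≫ a.inl⟦(1 : ℤ)⟧' + (c.snd ≫ η') ≫ a.inr⟦(1 : ℤ)⟧') ∈ distTriang D := by
  let T : Bool → Triangle D := Bool.rec (Triangle.mk f' g' η') (Triangle.mk f g η)
  have hT : ∀ j, T j ∈ distTriang D := by rintro (_ | _) <;> assumption
  have ha₁ : a.inl⟦(1 : ℤ)⟧' ≫ a.fst⟦(1 : ℤ)⟧' = 𝟙 _ := by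
    rw [← Functor.map_comp, a.inl_fst, CategoryTheory.Functor.map_id]
  have ha₂ : a.inr⟦(1 : ℤ)⟧' ≫ a.fst⟦(1 : ℤ)⟧' = 0 := by
    rw [← Functor.map_comp, a.inr_fst, Functor.map_zero]
  have ha₃ : a.inl⟦(1 : ℤ)⟧' ≫ a.snd⟦(1 : ℤ)⟧' = 0 := by
    rw [← Functor.map_comp, a.inl_snd, Functor.map_zero]
  have ha₄ : a.inr⟦(1 : ℤ)⟧' ≫ a.snd⟦(1 : ℤ)⟧' = 𝟙 _ := by
    rw [← Functor.map_comp, a.inr_snd, CategoryTheory.Functor.map_id]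
  let S := Triangle.mk (a.sumMap b f f') (b.sumMap c g g')
      ((c.fst ≫ η) ≫ a.inl⟦(1 : ℤ)⟧' + (c.snd ≫ η') ≫ a.inr⟦(1 : ℤ)⟧')
  have p₁ : a.sumMap b f f' ≫ b.fst = a.fst ≫ f := by
    simp [BinaryBicone.sumMap, Preadditive.add_comp]
  have p₂ : a.sumMap b f f' ≫ b.snd = a.snd ≫ f' := by
    simp [BinaryBicone.sumMap, Preadditive.add_comp]
  have q₁ : b.sumMap c g g' ≫ c.fst = b.fst ≫ g := by
    simp [BinaryBicone.sumMap, Preadditive.add_comp]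
  have q₂ : b.sumMap c g g' ≫ c.snd = b.snd ≫ g' := by
    simp [BinaryBicone.sumMap, Preadditive.add_comp]
  have r₁ : ((c.fst ≫ η) ≫ a.inl⟦(1 : ℤ)⟧' + (c.snd ≫ η') ≫ a.inr⟦(1 : ℤ)⟧') ≫
      a.fst⟦(1 : ℤ)⟧' = c.fst ≫ η := by
    rw [Preadditive.add_comp, assoc, assoc, assoc, assoc, ha₁, ha₂]; simp
  have r₂ : ((c.fst ≫ η) ≫ a.inl⟦(1 : ℤ)⟧' + (c.snd ≫ η') ≫ a.inr⟦(1 : ℤ)⟧') ≫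
      a.snd⟦(1 : ℤ)⟧' = c.snd ≫ η' := by
    rw [Preadditive.add_comp, assoc, assoc, assoc, assoc, ha₃, ha₄]; simp
  let φ₁ : S ⟶ Triangle.mk f g η :=
    Triangle.homMk S (Triangle.mk f g η) a.fst b.fst c.fst p₁ q₁ r₁
  let φ₂ : S ⟶ Triangle.mk f' g' η' :=
    Triangle.homMk S (Triangle.mk f' g' η') a.snd b.snd c.snd p₂ q₂ r₂
  let φ : ∀ j, S ⟶ T j := Bool.rec φ₂ φ₁
  have i₁ : IsIso (productTriangle.lift T φ).hom₁ :=
    isIso_pi_lift_bool (fun j ↦ (T j).obj₁) a ha (fun j ↦ (φ j).hom₁) rfl rfl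
  have i₂ : IsIso (productTriangle.lift T φ).hom₂ :=
    isIso_pi_lift_bool (fun j ↦ (T j).obj₂) b hb (fun j ↦ (φ j).hom₂) rfl rfl
  have i₃ : IsIso (productTriangle.lift T φ).hom₃ :=
    isIso_pi_lift_bool (fun j ↦ (T j).obj₃) c hc (fun j ↦ (φ j).hom₃) rfl rfl
  have := Triangle.isIso_of_isIsos (productTriangle.lift T φ) i₁ i₂ i₃
  exact isomorphic_distinguished _ (productTriangle_distinguished T hT) S
    (asIso (productTriangle.lift T φ))

/-- The extriangulated structure of an extension-closed full subcategory (closed under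
isomorphisms and containing zero) of a triangulated category `D`: `𝔼(Z, X) = D(Z, X⟦1⟧)`,
and an extension `η` is realized by the sequences `X ⟶ Y ⟶ Z` such that
`X ⟶ Y ⟶ Z --η--> X⟦1⟧` is a distinguished triangle of `D`. -/
def ofExtensionClosed [IsTriangulated D] (P : ObjectProperty D) [P.IsClosedUnderIsomorphisms]
    [P.IsTriangulatedClosed₂] [P.ContainsZero] :
    ExtriangulatedStructure.{v} P.FullSubcategory where
  Ext Z X := Z.obj ⟶ X.obj⟦(1 : ℤ)⟧
  addCommGroup Z X := Preadditive.homGroup Z.obj (X.obj⟦(1 : ℤ)⟧)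
  pull f :=
    { toFun η := f.hom ≫ η
      map_zero' := comp_zero
      map_add' η η' := Preadditive.comp_add _ _ _ f.hom η η' }
  push g :=
    { toFun η := η ≫ g.hom⟦(1 : ℤ)⟧'
      map_zero' := zero_comp
      map_add' η η' := Preadditive.add_comp _ _ _ η η' _ }
  pull_id η := id_comp η
  pull_comp f' f η := assoc f'.hom f.hom η
  push_id {Z X} η := by
    change η ≫ (𝟙 X.obj)⟦(1 : ℤ)⟧' = η
    rw [CategoryTheory.Functor.map_id, comp_id]
  push_comp g g' η := by
    change η ≫ (g.hom ≫ g'.hom)⟦(1 : ℤ)⟧' = (η ≫ g.hom⟦(1 : ℤ)⟧') ≫ g'.hom⟦(1 : ℤ)⟧'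
    rw [CategoryTheory.Functor.map_comp, assoc]
  push_pull f g η := assoc f.hom η _
  pull_add f f' η := Preadditive.add_comp _ _ _ f.hom f'.hom η
  push_add g g' η := by
    change η ≫ (g.hom + g'.hom)⟦(1 : ℤ)⟧' = η ≫ g.hom⟦(1 : ℤ)⟧' + η ≫ g'.hom⟦(1 : ℤ)⟧'
    rw [Functor.map_add, Preadditive.comp_add]
  Realizes η f g := Triangle.mk f.hom g.hom η ∈ distTriang D
  exists_realizes {X Z} η := by
    obtain ⟨Y, f, g, h⟩ := distinguished_cocone_triangle₂ η
    exact ⟨⟨Y, P.ext_of_isTriangulatedClosed₂ _ h X.property Z.property⟩, P.homMk f, P.homMk g, h⟩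
  realizes_iff {X Y Y' Z η f g} h f' g' := by
    constructor
    · intro h'
      obtain ⟨b, h₁, h₂⟩ := complete_distinguished_triangle_morphism₂ _ _ h h' (𝟙 X.obj) (𝟙 Z.obj)
        (show η ≫ (𝟙 X.obj)⟦(1 : ℤ)⟧' = 𝟙 Z.obj ≫ η by
          rw [CategoryTheory.Functor.map_id, comp_id, id_comp])
      have h₁' : f.hom ≫ b = f'.hom := h₁.trans (id_comp f'.hom)
      have h₂' : b ≫ g'.hom = g.hom := h₂.symm.trans (comp_id g.hom)
      have h₃ : η ≫ (𝟙 X.obj)⟦(1 : ℤ)⟧' = 𝟙 Z.obj ≫ η := by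
        rw [CategoryTheory.Functor.map_id, comp_id, id_comp]
      let φ : Triangle.mk f.hom g.hom η ⟶ Triangle.mk f'.hom g'.hom η :=
        Triangle.homMk _ _ (𝟙 X.obj) b (𝟙 Z.obj) h₁ h₂ h₃
      have hb : IsIso b := isIso₂_of_isIso₁₃ φ h h' (inferInstanceAs (IsIso (𝟙 X.obj)))
        (inferInstanceAs (IsIso (𝟙 Z.obj)))
      exact ⟨P.isoMk (@asIso _ _ _ _ b hb), InducedCategory.hom_ext h₁', InducedCategory.hom_ext h₂'⟩
    · rintro ⟨e, h₁, h₂⟩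
      have h₁' : f.hom ≫ (P.ι.mapIso e).hom = f'.hom := congrArg InducedCategory.Hom.hom h₁
      have h₂' : (P.ι.mapIso e).hom ≫ g'.hom = g.hom := congrArg InducedCategory.Hom.hom h₂
      exact isomorphic_distinguished _ h _ (Triangle.isoMk (Triangle.mk f'.hom g'.hom η)
        (Triangle.mk f.hom g.hom η) (Iso.refl X.obj) (P.ι.mapIso e).symm (Iso.refl Z.obj)
        (show f'.hom ≫ (P.ι.mapIso e).inv = 𝟙 X.obj ≫ f.hom by
          rw [← h₁', assoc, Iso.hom_inv_id, comp_id, id_comp])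
        (show g'.hom ≫ 𝟙 Z.obj = (P.ι.mapIso e).inv ≫ g.hom by
          rw [← h₂', Iso.inv_hom_id_assoc, comp_id])
        (show η ≫ (𝟙 X.obj)⟦(1 : ℤ)⟧' = 𝟙 Z.obj ≫ η by
          rw [CategoryTheory.Functor.map_id, comp_id, id_comp]))
  exists_hom₂ h h' a c hac := by
    obtain ⟨b, h₁, h₂⟩ := complete_distinguished_triangle_morphism₂ _ _ h h' a.hom c.hom hac
    exact ⟨P.homMk b, InducedCategory.hom_ext h₁, InducedCategory.hom_ext h₂⟩
  realizes_zero b hb := distinguished_of_bilimit (ambientBicone b) (ambientBicone_total hb)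
  realizes_sum h h' a ha b hb c hc :=
    distinguished_sum h h' (ambientBicone a) (ambientBicone_total ha)
      (ambientBicone b) (ambientBicone_total hb) (ambientBicone c) (ambientBicone_total hc)
  exists_hom₃ h h' a b hab := by
    obtain ⟨c, h₁, h₂⟩ := complete_distinguished_triangle_morphism _ _ h h' a.hom b.hom
      (congrArg InducedCategory.Hom.hom hab)
    exact ⟨P.homMk c, InducedCategory.hom_ext h₁, h₂⟩
  exists_hom₁ h h' b c hbc := by
    obtain ⟨a, h₁, h₂⟩ := complete_distinguished_triangle_morphism₁ _ _ h h' b.hom c.hom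
      (congrArg InducedCategory.Hom.hom hbc)
    exact ⟨P.homMk a, InducedCategory.hom_ext h₁, h₂⟩
  exists_octahedron {A B C' D' F f f' δ g g' δ'} h h' := by
    obtain ⟨E, k, δ'', h''⟩ := distinguished_cocone_triangle (f.hom ≫ g.hom)
    let o := someOctahedron rfl h h' h''
    exact ⟨⟨E, P.ext_of_isTriangulatedClosed₂ _ o.mem D'.property F.property⟩, P.homMk k,
      P.homMk o.m₁, P.homMk o.m₃, δ'', h'', o.mem, InducedCategory.hom_ext o.comm₁.symm,
      InducedCategory.hom_ext o.comm₃, o.comm₂, o.comm₄⟩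
  exists_octahedron_op {A B C' D' F f' f δ g' g δ'} h h' := by
    obtain ⟨E, k, δ'', h''⟩ := distinguished_cocone_triangle₁ (f.hom ≫ g.hom)
    let o := someOctahedron' rfl h h' h''
    exact ⟨⟨E, P.ext_of_isTriangulatedClosed₂ _ o.mem D'.property F.property⟩,
      P.homMk o.m₁, P.homMk o.m₃, P.homMk k, δ'', h'', o.mem, InducedCategory.hom_ext o.comm₁,
      InducedCategory.hom_ext o.comm₄.symm, o.comm₃, o.comm₂⟩

end Subcategory
end ExtriangulatedStructure

/-! ### t-structures and their extended hearts -/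

namespace CategoryTheory.Triangulated.TStructure

section

open scoped ZeroObject

variable {D : Type u} [Category.{v} D] [Preadditive D] [HasZeroObject D] [HasShift D ℤ]
  [∀ n : ℤ, (shiftFunctor D n).Additive] [Pretriangulated D] (x : TStructure D)

/-- A t-structure `(𝒰, 𝒲) = (x.le 0, x.ge 0)` is smashing if `𝒲` is closed under coproducts. -/
def IsSmashing : Prop :=
  ∀ I : Type t, (x.ge 0).IsClosedUnderColimitsOfShape (Discrete I)

/-- A t-structure `(𝒰, 𝒲) = (x.le 0, x.ge 0)` is co-smashing if `𝒰` is closed under products. -/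
def IsCoSmashing : Prop :=
  ∀ I : Type t, (x.le 0).IsClosedUnderLimitsOfShape (Discrete I)

/-- The extended heart `ℋ ⋆ Σ⁻¹ℋ` of length `2`, where `ℋ` is the heart: the objects `X` such that
there is a distinguished triangle `A ⟶ X ⟶ B ⟶ A⟦1⟧` with `A` and `B⟦1⟧` in `ℋ`. -/
def extendedHeart : ObjectProperty D :=
  x.heart.extensionProduct (x.heart.shift (1 : ℤ))

instance isTriangulatedClosed₂_le (n : ℤ) : (x.le n).IsTriangulatedClosed₂ :=
  .mk' fun T hT h₁ h₃ ↦ (x.isLE₂ T hT n ⟨h₁⟩ ⟨h₃⟩).le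

instance isTriangulatedClosed₂_ge (n : ℤ) : (x.ge n).IsTriangulatedClosed₂ :=
  .mk' fun T hT h₁ h₃ ↦ (x.isGE₂ T hT n ⟨h₁⟩ ⟨h₃⟩).ge

lemma heart_shift_one : x.heart.shift (1 : ℤ) = x.le 1 ⊓ x.ge 1 := by
  rw [← x.shift_le 1 0 1 (by lia), ← x.shift_ge 1 0 1 (by lia)]
  rfl

lemma extendedHeart_eq : x.extendedHeart = x.le 1 ⊓ x.ge 0 := by
  refine le_antisymm ?_ ?_
  · refine ObjectProperty.extensionProduct_le_of_isTriangulatedClosed₂ ?_ ?_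
    · exact fun X hX ↦ ⟨x.le_monotone (by lia) X hX.1, hX.2⟩
    · rw [heart_shift_one]
      exact fun X hX ↦ ⟨hX.1, x.ge_antitone (by lia) X hX.2⟩
  · rintro X ⟨h₁, h₀⟩
    obtain ⟨A, B, hA, hB, f, g, h, mem⟩ := x.exists_triangle X 0 1 (by lia)
    have hA' : x.ge 0 A := (x.ge 0).ext_of_isTriangulatedClosed₂ _ (inv_rot_of_distTriang _ mem)
      (x.ge_antitone (by lia) _ (x.ge_shift 1 (-1) 2 (by lia) B hB)) h₀
    have hB' : x.le 1 B := (x.le 1).ext_of_isTriangulatedClosed₂ _ (rot_of_distTriang _ mem) h₁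
      (x.le_monotone (by lia) _ (x.le_shift 0 1 (-1) (by lia) A hA))
    refine ⟨A, B, f, g, h, mem, ⟨hA, hA'⟩, ?_⟩
    rw [heart_shift_one]
    exact ⟨hB', hB⟩

instance : x.extendedHeart.IsClosedUnderIsomorphisms := by
  rw [extendedHeart_eq]; infer_instance

instance : x.extendedHeart.IsTriangulatedClosed₂ := by
  rw [extendedHeart_eq]; infer_instance

instance : x.extendedHeart.ContainsZero where
  exists_zero := by
    rw [extendedHeart_eq]
    exact ⟨0, isZero_zero D, (inferInstance : x.IsLE 0 1).le, (inferInstance : x.IsGE 0 0).ge⟩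

/-- The extriangulated structure of the extended heart, as an extension-closed subcategory of the
triangulated category `D`. -/
def extendedHeartExtriangulated [IsTriangulated D] :
    ExtriangulatedStructure.{v} x.extendedHeart.FullSubcategory :=
  .ofExtensionClosed x.extendedHeart

end

end CategoryTheory.Triangulated.TStructure

/-! ### Torsion pairs and the HRS-tilt -/

/-- A torsion pair `(𝒯, ℱ)` in an abelian category `A`. -/
structure TorsionPair (A : Type u) [Category.{v} A] [Abelian A] where
  /-- The torsion class `𝒯`. -/
  tors : ObjectProperty A
  /-- The torsionfree class `ℱ`. -/
  free : ObjectProperty A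
  [tors_isClosedUnderIsomorphisms : tors.IsClosedUnderIsomorphisms]
  [free_isClosedUnderIsomorphisms : free.IsClosedUnderIsomorphisms]
  hom_eq_zero {T F : A} (hT : tors T) (hF : free F) (f : T ⟶ F) : f = 0
  exists_shortExact (X : A) : ∃ (T F : A) (i : T ⟶ X) (p : X ⟶ F) (w : i ≫ p = 0),
    tors T ∧ free F ∧ (ShortComplex.mk i p w).ShortExact

namespace CategoryTheory.ObjectProperty

variable {D : Type u} [Category.{v} D] [Preadditive D] [HasZeroObject D] [HasShift D ℤ]
  [∀ n : ℤ, (shiftFunctor D n).Additive] [Pretriangulated D]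

lemma shift_extensionProduct (P Q : ObjectProperty D) [P.IsClosedUnderIsomorphisms]
    [Q.IsClosedUnderIsomorphisms] (a : ℤ) :
    (P.extensionProduct Q).shift a = (P.shift a).extensionProduct (Q.shift a) := by
  refine le_antisymm ?_ ?_
  · rintro X ⟨Y, Z, f, g, h, mem, hY, hZ⟩
    refine prop_of_iso _ ((shiftEquiv D a).unitIso.symm.app X)
      ⟨_, _, _, _, _, Triangle.shift_distinguished _ mem (-a), ?_, ?_⟩
    · exact P.prop_of_iso ((shiftEquiv D a).counitIso.symm.app Y) hY
    · exact Q.prop_of_iso ((shiftEquiv D a).counitIso.symm.app Z) hZ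
  · rintro X ⟨Y, Z, f, g, h, mem, hY, hZ⟩
    exact ⟨_, _, _, _, _, Triangle.shift_distinguished _ mem a, hY, hZ⟩

end CategoryTheory.ObjectProperty

namespace TorsionPair

open scoped ZeroObject

variable {A : Type u} [Category.{v} A] [Abelian A] (𝒯 : TorsionPair A)

attribute [instance] tors_isClosedUnderIsomorphisms free_isClosedUnderIsomorphisms

/-- A torsion pair `(𝒯, ℱ)` is smashing if `ℱ` is closed under coproducts. -/
def IsSmashing : Prop :=
  ∀ I : Type t, 𝒯.free.IsClosedUnderColimitsOfShape (Discrete I)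

/-- A torsion pair `(𝒯, ℱ)` is co-smashing if `𝒯` is closed under products. -/
def IsCoSmashing : Prop :=
  ∀ I : Type t, 𝒯.tors.IsClosedUnderLimitsOfShape (Discrete I)

instance : 𝒯.tors.ContainsZero where
  exists_zero := by
    obtain ⟨T, F, i, p, w, hT, hF, h⟩ := 𝒯.exists_shortExact 0
    have := h.mono_f
    exact ⟨T, (isZero_zero A).of_mono i, hT⟩

instance : 𝒯.free.ContainsZero where
  exists_zero := by
    obtain ⟨T, F, i, p, w, hT, hF, h⟩ := 𝒯.exists_shortExact 0
    have := h.epi_g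
    exact ⟨F, (isZero_zero A).of_epi p, hF⟩

section HRS

variable [HasDerivedCategory.{w} A]

open DerivedCategory (singleFunctor)

/-- `𝒰 = Σ𝒟^{≤0} ⋆ 𝒯`. -/
noncomputable def aisle : ObjectProperty (DerivedCategory A) :=
  ((DerivedCategory.TStructure.t.le 0).shift (-1 : ℤ)).extensionProduct
    (𝒯.tors.map (singleFunctor A 0))

/-- `𝒲 = Σℱ ⋆ 𝒟^{≥0}`. -/
noncomputable def coaisle : ObjectProperty (DerivedCategory A) :=
  ((𝒯.free.map (singleFunctor A 0)).shift (-1 : ℤ)).extensionProduct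
    (DerivedCategory.TStructure.t.ge 0)

lemma aisle_eq : 𝒯.aisle = (DerivedCategory.TStructure.t.le (-1)).extensionProduct
    (𝒯.tors.map (singleFunctor A 0)) := by
  rw [aisle, DerivedCategory.TStructure.t.shift_le (-1) 0 (-1) (by lia)]

lemma coaisle_shift : 𝒯.coaisle.shift (1 : ℤ) = (𝒯.free.map (singleFunctor A 0)).extensionProduct
    (DerivedCategory.TStructure.t.ge 1) := by
  rw [coaisle, ObjectProperty.shift_extensionProduct,
    ObjectProperty.shift_shift _ (1 : ℤ) (-1) 0 (by lia), ObjectProperty.shift_zero,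
    DerivedCategory.TStructure.t.shift_ge 1 0 1 (by lia)]

instance : 𝒯.aisle.IsClosedUnderIsomorphisms := by unfold aisle; infer_instance

instance : 𝒯.coaisle.IsClosedUnderIsomorphisms := by unfold coaisle; infer_instance

lemma map_single_le_le (P : ObjectProperty A) :
    P.map (singleFunctor A 0) ≤ DerivedCategory.TStructure.t.le 0 := by
  rintro X ⟨Y, -, ⟨e⟩⟩
  exact (DerivedCategory.TStructure.t.isLE_of_iso e 0).le

lemma map_single_le_ge (P : ObjectProperty A) :
    P.map (singleFunctor A 0) ≤ DerivedCategory.TStructure.t.ge 0 := by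
  rintro X ⟨Y, -, ⟨e⟩⟩
  exact (DerivedCategory.TStructure.t.isGE_of_iso e 0).ge

lemma aisle_le : 𝒯.aisle ≤ DerivedCategory.TStructure.t.le 0 := by
  rw [aisle_eq]
  exact ObjectProperty.extensionProduct_le_of_isTriangulatedClosed₂
    (DerivedCategory.TStructure.t.le_monotone (by lia)) (map_single_le_le _)

lemma coaisle_shift_le : 𝒯.coaisle.shift (1 : ℤ) ≤ DerivedCategory.TStructure.t.ge 0 := by
  rw [coaisle_shift]
  exact ObjectProperty.extensionProduct_le_of_isTriangulatedClosed₂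
    (map_single_le_ge _) (DerivedCategory.TStructure.t.ge_antitone (by lia))

lemma aisle_hom_eq_zero {X Y : DerivedCategory A} (f : X ⟶ Y) (hX : 𝒯.aisle X)
    (hY : 𝒯.coaisle.shift (1 : ℤ) Y) : f = 0 := by
  have h₁ : 𝒯.aisle ≤ (𝒯.free.map (singleFunctor A 0)).leftOrthogonal := by
    rw [aisle_eq]
    refine ObjectProperty.extensionProduct_le_of_isTriangulatedClosed₂ ?_ ?_
    · intro X hX Y f hY
      exact DerivedCategory.TStructure.t.zero_of_isLE_of_isGE f (-1) 0 (by lia) ⟨hX⟩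
        ⟨map_single_le_ge _ _ hY⟩
    · rintro X ⟨T, hT, ⟨e⟩⟩ Y f ⟨F, hF, ⟨e'⟩⟩
      obtain ⟨g, hg⟩ := (singleFunctor A 0).map_surjective (e.hom ≫ f ≫ e'.inv)
      rw [𝒯.hom_eq_zero hT hF g, Functor.map_zero] at hg
      rw [← cancel_epi e.hom, ← cancel_mono e'.inv, assoc, ← hg, comp_zero, zero_comp]
  have h₂ : 𝒯.coaisle.shift (1 : ℤ) ≤ 𝒯.aisle.rightOrthogonal := by
    rw [coaisle_shift]
    refine ObjectProperty.extensionProduct_le_of_isTriangulatedClosed₂ ?_ ?_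
    · exact fun Y hY X f hX ↦ h₁ X hX f hY
    · intro Y hY X f hX
      exact DerivedCategory.TStructure.t.zero_of_isLE_of_isGE f 0 1 (by lia) ⟨𝒯.aisle_le X hX⟩
        ⟨hY⟩
  exact h₂ Y hY f hX

lemma heart_le_extensionProduct : DerivedCategory.TStructure.t.heart ≤
    (𝒯.tors.map (singleFunctor A 0)).extensionProduct (𝒯.free.map (singleFunctor A 0)) := by
  rintro X ⟨h₁, h₂⟩
  have : X.IsLE 0 := ⟨h₁⟩
  have : X.IsGE 0 := ⟨h₂⟩
  obtain ⟨Y, ⟨e⟩⟩ := X.exists_iso_singleFunctor_obj_of_isGE_of_isLE 0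
  obtain ⟨T, F, i, p, w, hT, hF, h⟩ := 𝒯.exists_shortExact Y
  exact ObjectProperty.prop_of_iso _ e.symm ⟨_, _, _, _, _, h.singleTriangle_distinguished,
    ObjectProperty.prop_map_obj _ _ hT, ObjectProperty.prop_map_obj _ _ hF⟩

lemma ge_zero_le : DerivedCategory.TStructure.t.ge 0 ≤
    (DerivedCategory.TStructure.t (C := A)).heart.extensionProduct
      (DerivedCategory.TStructure.t.ge 1) := by
  intro X hX
  let x := DerivedCategory.TStructure.t (C := A)
  obtain ⟨Y, Z, hY, hZ, f, g, h, mem⟩ := x.exists_triangle X 0 1 (by lia)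
  have hY' : x.ge 0 Y := (x.ge 0).ext_of_isTriangulatedClosed₂ _ (inv_rot_of_distTriang _ mem)
    (x.ge_antitone (by lia) _ (x.ge_shift 1 (-1) 2 (by lia) Z hZ)) hX
  exact ⟨Y, Z, f, g, h, mem, ⟨hY, hY'⟩, hZ⟩

lemma extensionProduct_aisle_coaisle (X : DerivedCategory A) :
    𝒯.aisle.extensionProduct (𝒯.coaisle.shift (1 : ℤ)) X := by
  rw [aisle_eq, coaisle_shift, ObjectProperty.extensionProduct_assoc,
    ← ObjectProperty.extensionProduct_assoc (𝒯.tors.map (singleFunctor A 0))]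
  obtain ⟨Y, Z, hY, hZ, f, g, h, mem⟩ :=
    DerivedCategory.TStructure.t.exists_triangle X (-1) 0 (by lia)
  exact ⟨Y, Z, f, g, h, mem, hY, ObjectProperty.monotone_extensionProduct_left _
    𝒯.heart_le_extensionProduct _ (ge_zero_le Z hZ)⟩

/-- The HRS-tilt of the standard t-structure on the derived category at a torsion pair `(𝒯, ℱ)`:
the t-structure `(𝒰, 𝒲) = (Σ𝒟^{≤0} ⋆ 𝒯, Σℱ ⋆ 𝒟^{≥0})`. -/
noncomputable def tilt : TStructure (DerivedCategory A) where
  le n := 𝒯.aisle.shift n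
  ge n := 𝒯.coaisle.shift n
  le_shift n a n' h X hX := by
    rwa [← ObjectProperty.shift_shift _ a n' n h] at hX
  ge_shift n a n' h X hX := by
    rwa [← ObjectProperty.shift_shift _ a n' n h] at hX
  zero' X Y f hX hY := by
    rw [ObjectProperty.shift_zero] at hX
    exact 𝒯.aisle_hom_eq_zero f hX hY
  le_zero_le := by
    rw [ObjectProperty.shift_zero]
    intro X hX
    change 𝒯.aisle (X⟦(1 : ℤ)⟧)
    rw [aisle_eq]
    exact ObjectProperty.le_extensionProduct_left _ _
      (DerivedCategory.TStructure.t.le_shift 0 1 (-1) (by lia) X (𝒯.aisle_le X hX))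
  ge_one_le := by
    rw [ObjectProperty.shift_zero]
    have : ((𝒯.free.map (singleFunctor A 0)).shift (-1 : ℤ)).ContainsZero :=
      ⟨⟨0, isZero_zero _, (𝒯.free.map (singleFunctor A 0)).prop_of_isZero
        ((shiftFunctor (DerivedCategory A) (-1 : ℤ)).map_isZero (isZero_zero _))⟩⟩
    exact fun X hX ↦ ObjectProperty.le_extensionProduct_right _ _ (𝒯.coaisle_shift_le X hX)
  exists_triangle_zero_one X := by
    rw [ObjectProperty.shift_zero]
    obtain ⟨Y, Z, f, g, h, mem, hY, hZ⟩ := 𝒯.extensionProduct_aisle_coaisle X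
    exact ⟨Y, Z, hY, hZ, f, g, h, mem⟩

lemma tilt_le_zero : 𝒯.tilt.le 0 = 𝒯.aisle := 𝒯.aisle.shift_zero ℤ

lemma tilt_ge_zero : 𝒯.tilt.ge 0 = 𝒯.coaisle := 𝒯.coaisle.shift_zero ℤ

end HRS

end TorsionPair

/-! ### Coproducts and products in localized categories -/

namespace CategoryTheory

/-! The cycle of implications is (b) ⇒ (a) ⇒ (c) ⇒ (d) ⇒ (b). Its foundation is that under AB4
coproducts in `𝒟` are computed on complexes: homology commutes with coproducts, so
quasi-isomorphisms are stable under them, and a localization with a calculus of right fractions then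
preserves them (`Localization.preservesColimitsOfShape_discrete`). Hence `𝒟` has coproducts, and
both the homology functors and the embedding of `A` in degree `0` preserve them. A coproduct of
distinguished triangles is distinguished (`distinguished_of_isColimit_cofan`).

(b) ⇒ (a): `ℱ` in degree `0` and `𝒟^{≥0}` are closed under coproducts, hence so is the class of
extensions `Σℱ ⋆ 𝒟^{≥0}`. (a) ⇒ (c): the extended heart is `x.le 1 ⊓ x.ge 0`. An aisle is a left
orthogonal, so it is always closed under coproducts; smashing handles the other factor. Thus
coproducts of `𝒞` are those of `𝒟`, and `Γ` is forced by its restrictions to the summands, which is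
the AET4 condition. (c) ⇒ (d) forgets that condition. (d) ⇒ (b): let `Y` be the coproduct in `A` of
objects `Xᵢ` of `ℱ`. The inclusions `Xᵢ ⟶ Y` give triangles `Y ⟶ Coker ⟶ ΣXᵢ` in `𝒞` with constant
first term, which is the shape AET3.5 applies to. Coproducts of the first two terms lie in `A ⊆ 𝒞`,
so they agree in `𝒞` and in `𝒟`. AET3.5 makes the cone of the map between them an object of `𝒞`; in
`𝒟` this cone is `ΣY`. So `ΣY` lies in `𝒲`, all maps from `𝒯` to `Y` vanish, and `Y` is in `ℱ`
(`IsAET35.prop_of_isColimit_cofan`, `isSmashing_of_isAET35`).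

Part (2) is dual in substance. Since `𝒟(A)ᵒᵖ` is not used as a derived category, the product
statements are mostly proved alongside; only the localization argument passes to opposite
categories. -/

lemma MorphismProperty.isStableUnderColimitsOfShape_op {C J : Type*} [Category* C] [Category* J]
    (W : MorphismProperty C) [W.IsStableUnderLimitsOfShape J] :
    W.op.IsStableUnderColimitsOfShape Jᵒᵖ where
  condition X₁ X₂ c₁ c₂ h₁ h₂ f hf φ hφ :=
    MorphismProperty.IsStableUnderLimitsOfShape.condition (W := W) X₂.unop X₁.unop
      (coneUnopOfCocone c₂) (coneUnopOfCocone c₁) (isLimitConeUnopOfCocone _ h₂)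
      (isLimitConeUnopOfCocone _ h₁) (NatTrans.unop f) (fun j ↦ hf (.op j)) φ.unop
      (fun j ↦ Quiver.Hom.op_inj (hφ (.op j)))

lemma MorphismProperty.isStableUnderCoproductsOfShape_op {C I : Type*} [Category* C]
    (W : MorphismProperty C) [W.IsStableUnderProductsOfShape I] :
    W.op.IsStableUnderCoproductsOfShape I := by
  have := W.isStableUnderColimitsOfShape_op (J := Discrete I)
  unfold IsStableUnderCoproductsOfShape
  rw [isStableUnderColimitsOfShape_iff_colimitsOfShape_le] at this ⊢
  rwa [colimitsOfShape_eq_of_equivalence _ (Discrete.opposite I).symm]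

/-- Since `L` is essentially surjective, the universal property of the image cofan need only be
tested on targets `L.obj Y`. There it splits into existence and uniqueness, which are verified
separately for the homotopy quotient and for localizations. -/
lemma preservesCoproductsOfShape_of_exists_of_hom_ext {C D I : Type*} [Category* C] [Category* D]
    (L : C ⥤ D) [L.EssSurj] [HasColimitsOfShape (Discrete I) C]
    (hL : ∀ (X : I → C) (Y : C) (f : ∀ i, L.obj (X i) ⟶ L.obj Y),
      ∃ g : L.obj (∐ X) ⟶ L.obj Y, ∀ i, L.map (Limits.Sigma.ι X i) ≫ g = f i)
    (hL' : ∀ (X : I → C) (Y : C) (f f' : L.obj (∐ X) ⟶ L.obj Y),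
      (∀ i, L.map (Limits.Sigma.ι X i) ≫ f = L.map (Limits.Sigma.ι X i) ≫ f') → f = f') :
    PreservesColimitsOfShape (Discrete I) L := by
  have (X : I → C) : PreservesColimit (Discrete.functor X) L :=
    preservesColimit_of_preserves_colimit_cocone (coproductIsCoproduct X) <| by
      refine (isColimitMapCoconeCofanMkEquiv L _ _).symm ?_
      choose g hg using fun (Y : D) (f : ∀ i, L.obj (X i) ⟶ Y) ↦
        hL X _ (fun i ↦ f i ≫ (L.objObjPreimageIso Y).inv)
      refine Cofan.IsColimit.mk _ (fun s ↦ g s.pt s.inj ≫ (L.objObjPreimageIso s.pt).hom) ?_ ?_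
      · intro s i
        have := hg s.pt s.inj i
        dsimp at this ⊢
        rw [reassoc_of% this]
        simp
      · intro s m hm
        rw [← cancel_mono (L.objObjPreimageIso s.pt).inv]
        refine hL' _ _ _ _ fun i ↦ ?_
        have h₁ := hg s.pt s.inj i
        have h₂ := hm i
        dsimp at h₁ h₂ ⊢
        rw [reassoc_of% h₂, assoc, Iso.hom_inv_id, comp_id, h₁]
  exact preservesColimitsOfShape_of_discrete L

lemma preservesProductsOfShape_of_exists_of_hom_ext {C D I : Type*} [Category* C] [Category* D]
    (L : C ⥤ D) [L.EssSurj] [HasLimitsOfShape (Discrete I) C]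
    (hL : ∀ (X : I → C) (Y : C) (f : ∀ i, L.obj Y ⟶ L.obj (X i)),
      ∃ g : L.obj Y ⟶ L.obj (∏ᶜ X), ∀ i, g ≫ L.map (Limits.Pi.π X i) = f i)
    (hL' : ∀ (X : I → C) (Y : C) (f f' : L.obj Y ⟶ L.obj (∏ᶜ X)),
      (∀ i, f ≫ L.map (Limits.Pi.π X i) = f' ≫ L.map (Limits.Pi.π X i)) → f = f') :
    PreservesLimitsOfShape (Discrete I) L := by
  have (X : I → C) : PreservesLimit (Discrete.functor X) L :=
    preservesLimit_of_preserves_limit_cone (productIsProduct X) <| by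
      refine (isLimitMapConeFanMkEquiv L _ _).symm ?_
      choose g hg using fun (Y : D) (f : ∀ i, Y ⟶ L.obj (X i)) ↦
        hL X _ (fun i ↦ (L.objObjPreimageIso Y).hom ≫ f i)
      refine Fan.IsLimit.mk _ (fun s ↦ (L.objObjPreimageIso s.pt).inv ≫ g s.pt s.proj) ?_ ?_
      · intro s i
        have := hg s.pt s.proj i
        dsimp at this ⊢
        rw [assoc, this]
        simp
      · intro s m hm
        rw [← cancel_epi (L.objObjPreimageIso s.pt).hom]
        refine hL' _ _ _ _ fun i ↦ ?_
        have h₁ := hg s.pt s.proj i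
        have h₂ := hm i
        dsimp at h₁ h₂ ⊢
        rw [assoc, h₂, Iso.hom_inv_id_assoc, h₁]
  exact preservesLimitsOfShape_of_discrete L

lemma isStableUnderLimitsOfShape_isomorphisms (C J : Type*) [Category* C] [Category* J] :
    (MorphismProperty.isomorphisms C).IsStableUnderLimitsOfShape J where
  condition X₁ X₂ c₁ c₂ h₁ h₂ f hf φ hφ := by
    have (j : J) : IsIso (f.app j) := hf j
    have := NatIso.isIso_of_isIso_app f
    have : φ = (IsLimit.conePointsIsoOfNatIso h₁ h₂ (asIso f)).hom :=
      h₂.hom_ext fun j ↦ by simpa using hφ j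
    rw [this]
    exact inferInstanceAs (IsIso _)

section LocalizationCoproducts

variable {C D : Type*} [Category* C] [Category* D] (L : C ⥤ D) (W : MorphismProperty C)
  [L.IsLocalization W] {I : Type*}

include W in
-- Write each morphism as a roof. The coproduct of the denominators again lies in `W`, so the
-- coproduct of the roofs is a roof out of the whole coproduct.
lemma Localization.exists_comp_ι_eq [W.HasRightCalculusOfFractions]
    [HasColimitsOfShape (Discrete I) C] [W.IsStableUnderCoproductsOfShape I]
    {X : I → C} (c : Cofan X) (hc : IsColimit c) {Y : C} (f : ∀ i, L.obj (X i) ⟶ L.obj Y) :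
    ∃ g : L.obj c.pt ⟶ L.obj Y, ∀ i, L.map (c.inj i) ≫ g = f i := by
  choose φ hφ using fun i ↦ Localization.exists_rightFraction L W (f i)
  let S : (∐ fun i ↦ (φ i).X') ⟶ c.pt := Limits.Sigma.desc fun i ↦ (φ i).s ≫ c.inj i
  have hS : W S :=
    MorphismProperty.IsStableUnderColimitsOfShape.condition (W := W) (J := Discrete I)
      (Discrete.functor fun i ↦ (φ i).X') _ _ _ (colimit.isColimit _) hc
      (Discrete.natTrans fun i ↦ (φ i.as).s) (fun i ↦ (φ i.as).hs) _
      (fun i ↦ Limits.Sigma.ι_desc _ _)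
  have := Localization.inverts L W S hS
  refine ⟨inv (L.map S) ≫ L.map (Limits.Sigma.desc fun i ↦ (φ i).f), fun i ↦ ?_⟩
  have := Localization.inverts L W (φ i).s (φ i).hs
  rw [← cancel_epi (L.map (φ i).s), hφ i, MorphismProperty.RightFraction.map_s_comp_map,
    ← L.map_comp_assoc,
    show (φ i).s ≫ c.inj i = Limits.Sigma.ι (fun i ↦ (φ i).X') i ≫ S by simp [S],
    L.map_comp_assoc, IsIso.hom_inv_id_assoc, ← L.map_comp, Limits.Sigma.ι_desc]

include W in
lemma Localization.hom_ext_of_cofan [W.HasRightCalculusOfFractions]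
    [HasColimitsOfShape (Discrete I) C] [W.IsStableUnderCoproductsOfShape I]
    {X : I → C} (c : Cofan X) (hc : IsColimit c) {Y : C} {f f' : L.obj c.pt ⟶ L.obj Y}
    (h : ∀ i, L.map (c.inj i) ≫ f = L.map (c.inj i) ≫ f') : f = f' := by
  -- The second roof represents `f'` precomposed with the denominator of the first, so `φ'.s ≫ φ.s`
  -- is a common denominator of `f` and `f'`.
  obtain ⟨φ, hφ⟩ := Localization.exists_rightFraction L W f
  have := Localization.inverts L W φ.s φ.hs
  obtain ⟨φ', hφ'⟩ := Localization.exists_rightFraction L W (L.map φ.s ≫ f')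
  have := Localization.inverts L W φ'.s φ'.hs
  -- The Ore condition pulls the common denominator back along each coprojection.
  choose ψ hψ using fun i ↦ (MorphismProperty.LeftFraction.mk (W := W) (c.inj i) (φ'.s ≫ φ.s)
    (W.comp_mem _ _ φ'.hs φ.hs)).exists_rightFraction
  dsimp at hψ
  have hψW (i : I) := Localization.inverts L W (ψ i).s (ψ i).hs
  have h₁ (i : I) : L.map ((ψ i).f ≫ φ'.s ≫ φ.f) = L.map ((ψ i).f ≫ φ'.f) := by
    have e₁ : L.map φ.f = L.map φ.s ≫ f := by
      rw [hφ, MorphismProperty.RightFraction.map_s_comp_map]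
    have e₂ : L.map φ'.f = L.map φ'.s ≫ L.map φ.s ≫ f' := by
      rw [hφ', MorphismProperty.RightFraction.map_s_comp_map]
    have e₃ : L.map (ψ i).f ≫ L.map φ'.s ≫ L.map φ.s = L.map (ψ i).s ≫ L.map (c.inj i) := by
      simp only [← L.map_comp, hψ i]
    have e₄ := L.map (ψ i).s ≫= h i
    rw [L.map_comp, L.map_comp, L.map_comp, e₁, e₂]
    rw [← assoc, ← assoc, ← e₃] at e₄
    simpa using e₄
  -- The numerators agree on each summand only after localization; a further denominator `s i` makes
  -- them agree in `C`.
  choose Z s hs hs' using fun i ↦ (MorphismProperty.map_eq_iff_precomp L W _ _).1 (h₁ i)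
  -- The refined denominators are collected into a single morphism of `W`, which factors through the
  -- common denominator via `k`; `k` equalizes the numerators because it does so on each summand.
  let S : (∐ Z) ⟶ c.pt := Limits.Sigma.desc fun i ↦ (s i ≫ (ψ i).s) ≫ c.inj i
  have hS : W S :=
    MorphismProperty.IsStableUnderColimitsOfShape.condition (W := W) (J := Discrete I)
      (Discrete.functor Z) _ _ _ (colimit.isColimit _) hc
      (Discrete.natTrans fun i ↦ s i.as ≫ (ψ i.as).s)
      (fun i ↦ W.comp_mem _ _ (hs i.as) (ψ i.as).hs) _ (fun i ↦ Limits.Sigma.ι_desc _ _)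
  have := Localization.inverts L W S hS
  let k : (∐ Z) ⟶ φ'.X' := Limits.Sigma.desc fun i ↦ s i ≫ (ψ i).f
  have hk : k ≫ φ'.s ≫ φ.s = S :=
    Limits.Sigma.hom_ext _ _ fun i ↦ by simp [k, S, hψ]
  have hk' : k ≫ φ'.s ≫ φ.f = k ≫ φ'.f :=
    Limits.Sigma.hom_ext _ _ fun i ↦ by simpa [k] using hs' i
  rw [← cancel_epi (L.map S), ← hk]
  have e₁ : L.map φ.f = L.map φ.s ≫ f := by
    rw [hφ, MorphismProperty.RightFraction.map_s_comp_map]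
  have e₂ : L.map φ'.f = L.map φ'.s ≫ L.map φ.s ≫ f' := by
    rw [hφ', MorphismProperty.RightFraction.map_s_comp_map]
  have e₃ := congrArg L.map hk'
  simp only [L.map_comp, e₁, e₂] at e₃
  simpa using e₃

include W in
/-- A localization functor with a calculus of right fractions preserves coproducts when the class
of inverted morphisms is stable under coproducts. -/
lemma Localization.preservesColimitsOfShape_discrete [W.HasRightCalculusOfFractions]
    [HasColimitsOfShape (Discrete I) C] [W.IsStableUnderCoproductsOfShape I] :
    PreservesColimitsOfShape (Discrete I) L := by
  have := Localization.essSurj L W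
  exact preservesCoproductsOfShape_of_exists_of_hom_ext L
    (fun X _ f ↦ Localization.exists_comp_ι_eq L W _ (coproductIsCoproduct X) f)
    (fun X _ _ _ h ↦ Localization.hom_ext_of_cofan L W _ (coproductIsCoproduct X) h)

include W in
/-- A localization functor with a calculus of left fractions preserves products when the class
of inverted morphisms is stable under products. -/
lemma Localization.preservesLimitsOfShape_discrete [W.HasLeftCalculusOfFractions]
    [HasLimitsOfShape (Discrete I) C] [W.IsStableUnderProductsOfShape I] :
    PreservesLimitsOfShape (Discrete I) L := by
  -- Apply the coproduct statement to `L.op`; the shape `(Discrete I)ᵒᵖ` is exchanged for `Discrete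
  -- I` by their equivalence.
  have : HasColimitsOfShape (Discrete I) Cᵒᵖ := hasCoproductsOfShape_opposite I
  have := W.isStableUnderCoproductsOfShape_op (I := I)
  have := Localization.preservesColimitsOfShape_discrete L.op W.op (I := I)
  have := preservesColimitsOfShape_of_equiv (Discrete.opposite I).symm L.op
  exact preservesLimitsOfShape_of_op (Discrete I) L

variable {L} in
-- Over a discrete shape a diagram lifts along `L` object by object, with no morphisms to match.
lemma hasCoproductsOfShape_of_essSurj [L.EssSurj] [HasColimitsOfShape (Discrete I) C]
    [PreservesColimitsOfShape (Discrete I) L] : HasColimitsOfShape (Discrete I) D where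
  has_colimit K :=
    hasColimit_of_iso (F := Discrete.functor (fun i ↦ L.objPreimage (K.obj ⟨i⟩)) ⋙ L)
      (Discrete.natIso fun i ↦ (L.objObjPreimageIso (K.obj i)).symm)

variable {L} in
lemma hasProductsOfShape_of_essSurj [L.EssSurj] [HasLimitsOfShape (Discrete I) C]
    [PreservesLimitsOfShape (Discrete I) L] : HasLimitsOfShape (Discrete I) D where
  has_limit K :=
    hasLimit_of_iso (F := Discrete.functor (fun i ↦ L.objPreimage (K.obj ⟨i⟩)) ⋙ L)
      (Discrete.natIso fun i ↦ (L.objObjPreimageIso (K.obj i)))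

variable {L} in
lemma preservesCoproductsOfShape_of_essSurj_comp {E : Type*} [Category* E] (F : D ⥤ E)
    [L.EssSurj] [HasColimitsOfShape (Discrete I) C]
    [PreservesColimitsOfShape (Discrete I) L] [PreservesColimitsOfShape (Discrete I) (L ⋙ F)] :
    PreservesColimitsOfShape (Discrete I) F where
  preservesColimit {K} := by
    let X := Discrete.functor (fun i ↦ L.objPreimage (K.obj ⟨i⟩))
    have : PreservesColimit (X ⋙ L) F :=
      preservesColimit_of_preserves_colimit_cocone
        (isColimitOfPreserves L (colimit.isColimit X))
        (isColimitOfPreserves (L ⋙ F) (colimit.isColimit X))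
    exact preservesColimit_of_iso_diagram F
      (Discrete.natIso fun i ↦ (L.objObjPreimageIso (K.obj i)) : X ⋙ L ≅ K)

variable {L} in
lemma preservesProductsOfShape_of_essSurj_comp {E : Type*} [Category* E] (F : D ⥤ E)
    [L.EssSurj] [HasLimitsOfShape (Discrete I) C]
    [PreservesLimitsOfShape (Discrete I) L] [PreservesLimitsOfShape (Discrete I) (L ⋙ F)] :
    PreservesLimitsOfShape (Discrete I) F where
  preservesLimit {K} := by
    let X := Discrete.functor (fun i ↦ L.objPreimage (K.obj ⟨i⟩))
    have : PreservesLimit (X ⋙ L) F :=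
      preservesLimit_of_preserves_limit_cone
        (isLimitOfPreserves L (limit.isLimit X))
        (isLimitOfPreserves (L ⋙ F) (limit.isLimit X))
    exact preservesLimit_of_iso_diagram F
      (Discrete.natIso fun i ↦ (L.objObjPreimageIso (K.obj i)) : X ⋙ L ≅ K)

end LocalizationCoproducts

end CategoryTheory

/-! ### Exactness of colimits and homology -/

namespace CategoryTheory
section Homology

variable {A : Type*} [Category* A] [Abelian A] (J : Type*) [Category* J]

/-- The coprojections of colimits of shape `J`, as a natural transformation. -/
noncomputable def evaluationToColim [HasColimitsOfShape J A] (j : J) :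
    (evaluation J A).obj j ⟶ colim where
  app F := colimit.ι F j

/-- The projections of limits of shape `J`, as a natural transformation. -/
noncomputable def limToEvaluation [HasLimitsOfShape J A] (j : J) :
    lim ⟶ (evaluation J A).obj j where
  app F := limit.π F j

namespace ShortComplex

/-- A diagram of short complexes is a short complex `S` in `J ⥤ A`. Both `colim` and the evaluations
are exact, so they commute with homology; the homology of the colimit is therefore the colimit of
the homologies, compatibly with the coprojections. -/
instance preservesColimitsOfShape_homologyFunctor [HasColimitsOfShape J A]
    [HasExactColimitsOfShape J A] :
    PreservesColimitsOfShape J (homologyFunctor A) where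
  preservesColimit {F} := by
    let S := (functorEquivalence J A).inverse.obj F
    let c : Cocone ((functorEquivalence J A).functor.obj S) :=
      { pt := S.map colim
        ι.app j := S.mapNatTrans (evaluationToColim J j)
        ι.naturality j j' f := by
          ext
          · exact (colimit.w S.X₁ f).trans (comp_id _).symm
          · exact (colimit.w S.X₂ f).trans (comp_id _).symm
          · exact (colimit.w S.X₃ f).trans (comp_id _).symm }
    have hc : IsColimit c := isColimitOfIsColimitπ c (colimit.isColimit S.X₁)
      (colimit.isColimit S.X₂) (colimit.isColimit S.X₃)
    let e : (functorEquivalence J A).functor.obj S ⋙ homologyFunctor A ≅ S.homology :=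
      NatIso.ofComponents (fun j ↦ S.mapHomologyIso ((evaluation J A).obj j)) fun f ↦
        (Iso.inv_comp_eq _).1 (NatTrans.app_homology ((evaluation J A).map f) S).symm
    have hc' : IsColimit ((homologyFunctor A).mapCocone c) :=
      IsColimit.ofIsoColimit
        ((IsColimit.precomposeHomEquiv e _).symm (colimit.isColimit S.homology))
        (Cocone.ext (S.mapHomologyIso colim).symm fun j ↦
          (Iso.comp_inv_eq _).2 ((Iso.eq_inv_comp _).1
            (NatTrans.app_homology (evaluationToColim J j) S)))
    have := preservesColimit_of_preserves_colimit_cocone hc hc'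
    exact preservesColimit_of_iso_diagram (K₁ := (functorEquivalence J A).functor.obj S) _
      ((functorEquivalence J A).counitIso.app F)

instance preservesLimitsOfShape_homologyFunctor [HasLimitsOfShape J A]
    [HasExactLimitsOfShape J A] :
    PreservesLimitsOfShape J (homologyFunctor A) where
  preservesLimit {F} := by
    let S := (functorEquivalence J A).inverse.obj F
    let c : Cone ((functorEquivalence J A).functor.obj S) :=
      { pt := S.map lim
        π.app j := S.mapNatTrans (limToEvaluation J j)
        π.naturality j j' f := by
          ext
          · exact (id_comp _).trans (limit.w S.X₁ f).symm
          · exact (id_comp _).trans (limit.w S.X₂ f).symm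
          · exact (id_comp _).trans (limit.w S.X₃ f).symm }
    have hc : IsLimit c := isLimitOfIsLimitπ c (limit.isLimit S.X₁)
      (limit.isLimit S.X₂) (limit.isLimit S.X₃)
    let e : S.homology ≅ (functorEquivalence J A).functor.obj S ⋙ homologyFunctor A :=
      NatIso.ofComponents (fun j ↦ (S.mapHomologyIso ((evaluation J A).obj j)).symm) fun f ↦
        (Iso.comp_inv_eq _).2 ((NatTrans.app_homology ((evaluation J A).map f) S).trans
          (assoc _ _ _).symm)
    have hc' : IsLimit ((homologyFunctor A).mapCone c) :=
      IsLimit.ofIsoLimit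
        ((IsLimit.postcomposeHomEquiv e _).symm (limit.isLimit S.homology))
        (Cone.ext (S.mapHomologyIso lim).symm fun j ↦
          (Iso.comp_inv_eq _).2 ((NatTrans.app_homology (limToEvaluation J j) S).trans
            (assoc _ _ _).symm))
    have := preservesLimit_of_preserves_limit_cone hc hc'
    exact preservesLimit_of_iso_diagram (K₁ := (functorEquivalence J A).functor.obj S) _
      ((functorEquivalence J A).counitIso.app F)

end ShortComplex
end Homology
end CategoryTheory

namespace HomologicalComplex

variable {A : Type*} [Category* A] [Abelian A] (J : Type*) [Category* J] {ι : Type*}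
  (c : ComplexShape ι) (n : ι)

instance preservesColimitsOfShape_shortComplexFunctor [HasColimitsOfShape J A] :
    PreservesColimitsOfShape J (shortComplexFunctor A c n) where
  preservesColimit {F} :=
    preservesColimit_of_preserves_colimit_cocone (colimit.isColimit F)
      (ShortComplex.isColimitOfIsColimitπ _
        (isColimitOfPreserves (eval A c (c.prev n)) (colimit.isColimit F))
        (isColimitOfPreserves (eval A c n) (colimit.isColimit F))
        (isColimitOfPreserves (eval A c (c.next n)) (colimit.isColimit F)))

instance preservesLimitsOfShape_shortComplexFunctor [HasLimitsOfShape J A] :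
    PreservesLimitsOfShape J (shortComplexFunctor A c n) where
  preservesLimit {F} :=
    preservesLimit_of_preserves_limit_cone (limit.isLimit F)
      (ShortComplex.isLimitOfIsLimitπ _
        (isLimitOfPreserves (eval A c (c.prev n)) (limit.isLimit F))
        (isLimitOfPreserves (eval A c n) (limit.isLimit F))
        (isLimitOfPreserves (eval A c (c.next n)) (limit.isLimit F)))

instance preservesColimitsOfShape_homologyFunctor [HasColimitsOfShape J A]
    [HasExactColimitsOfShape J A] : PreservesColimitsOfShape J (homologyFunctor A c n) :=
  preservesColimitsOfShape_of_natIso (homologyFunctorIso A c n).symm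

instance preservesLimitsOfShape_homologyFunctor [HasLimitsOfShape J A]
    [HasExactLimitsOfShape J A] : PreservesLimitsOfShape J (homologyFunctor A c n) :=
  preservesLimitsOfShape_of_natIso (homologyFunctorIso A c n).symm

end HomologicalComplex

/-! ### Coproducts and products in the homotopy category -/

namespace HomotopyCategory

variable {A : Type*} [Category* A] [Abelian A] {I : Type*} {ι : Type*} (c : ComplexShape ι)

/-- Homotopies on the components of a coproduct assemble to a homotopy. -/
noncomputable def _root_.Homotopy.ofCofan {X : I → HomologicalComplex A c} {s : Cofan X}
    (hs : ∀ n, IsColimit (Cofan.mk (s.pt.X n) fun i ↦ (s.inj i).f n))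
    {Y : HomologicalComplex A c} {f g : s.pt ⟶ Y}
    (h : ∀ i, Homotopy (s.inj i ≫ f) (s.inj i ≫ g)) : Homotopy f g := by
  let k (p q : ι) : s.pt.X p ⟶ Y.X q := Cofan.IsColimit.desc (hs p) fun i ↦ (h i).hom p q
  have hk (p q : ι) (i : I) : (s.inj i).f p ≫ k p q = (h i).hom p q :=
    Cofan.IsColimit.fac (hs p) _ i
  refine
    { hom := k
      zero p q hpq := Cofan.IsColimit.hom_ext (hs p) _ _ fun i ↦ ?_
      comm n := Cofan.IsColimit.hom_ext (hs n) _ _ fun i ↦ ?_ }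
  · exact (hk p q i).trans (((h i).zero p q hpq).trans comp_zero.symm)
  · have := (h i).comm n
    -- By `hk` the given homotopies are restrictions of `k`, so the coprojection can be pulled out
    -- of both homotopy terms and the identity checked on summands.
    have h₁ : dNext n (h i).hom = (s.inj i).f n ≫ dNext n k := by
      rw [← dNext_comp_left]
      simp only [hk]
    have h₂ : prevD n (h i).hom = (s.inj i).f n ≫ prevD n k := by
      rw [← prevD_comp_left]
      simp only [hk]
    rw [h₁, h₂, HomologicalComplex.comp_f, HomologicalComplex.comp_f, ← Preadditive.comp_add,
      ← Preadditive.comp_add] at this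
    exact this

/-- Homotopies on the components of a product assemble to a homotopy. -/
noncomputable def _root_.Homotopy.ofFan {X : I → HomologicalComplex A c} {s : Fan X}
    (hs : ∀ n, IsLimit (Fan.mk (s.pt.X n) fun i ↦ (s.proj i).f n))
    {Y : HomologicalComplex A c} {f g : Y ⟶ s.pt}
    (h : ∀ i, Homotopy (f ≫ s.proj i) (g ≫ s.proj i)) : Homotopy f g := by
  let k (p q : ι) : Y.X p ⟶ s.pt.X q := Fan.IsLimit.lift (hs q) fun i ↦ (h i).hom p q
  have hk (p q : ι) (i : I) : k p q ≫ (s.proj i).f q = (h i).hom p q :=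
    Fan.IsLimit.fac (hs q) _ i
  refine
    { hom := k
      zero p q hpq := Fan.IsLimit.hom_ext (hs q) _ _ fun i ↦ ?_
      comm n := Fan.IsLimit.hom_ext (hs n) _ _ fun i ↦ ?_ }
  · exact (hk p q i).trans (((h i).zero p q hpq).trans zero_comp.symm)
  · have := (h i).comm n
    have h₁ : dNext n (h i).hom = dNext n k ≫ (s.proj i).f n := by
      rw [← dNext_comp_right]
      simp only [hk]
    have h₂ : prevD n (h i).hom = prevD n k ≫ (s.proj i).f n := by
      rw [← prevD_comp_right]
      simp only [hk]
    rw [h₁, h₂, HomologicalComplex.comp_f, HomologicalComplex.comp_f, ← Preadditive.add_comp,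
      ← Preadditive.add_comp] at this
    exact this

/-- Existence holds because the quotient functor is full; uniqueness because homotopies on the
summands glue. -/
instance preservesColimitsOfShape_quotient [HasColimitsOfShape (Discrete I) A] :
    PreservesColimitsOfShape (Discrete I) (quotient A c) := by
  refine preservesCoproductsOfShape_of_exists_of_hom_ext _ (fun X Y f ↦ ?_) (fun X Y f f' h ↦ ?_)
  · choose g hg using fun i ↦ (quotient A c).map_surjective (f i)
    exact ⟨(quotient A c).map (Limits.Sigma.desc g), fun i ↦ by
      rw [← Functor.map_comp, Limits.Sigma.ι_desc, hg]⟩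
  · obtain ⟨f, rfl⟩ := (quotient A c).map_surjective f
    obtain ⟨f', rfl⟩ := (quotient A c).map_surjective f'
    exact eq_of_homotopy _ _ (Homotopy.ofCofan c (s := Cofan.mk _ (Limits.Sigma.ι X))
      (fun n ↦ (Cofan.isColimitMapCoconeEquiv (HomologicalComplex.eval A c n) _ _)
        (isColimitOfPreserves _ (coproductIsCoproduct X)))
      fun i ↦ homotopyOfEq _ _ (by rw [Functor.map_comp, Functor.map_comp]; exact h i))

instance preservesLimitsOfShape_quotient [HasLimitsOfShape (Discrete I) A] :
    PreservesLimitsOfShape (Discrete I) (quotient A c) := by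
  refine preservesProductsOfShape_of_exists_of_hom_ext _ (fun X Y f ↦ ?_) (fun X Y f f' h ↦ ?_)
  · choose g hg using fun i ↦ (quotient A c).map_surjective (f i)
    exact ⟨(quotient A c).map (Limits.Pi.lift g), fun i ↦ by
      rw [← Functor.map_comp, Limits.Pi.lift_π, hg]⟩
  · obtain ⟨f, rfl⟩ := (quotient A c).map_surjective f
    obtain ⟨f', rfl⟩ := (quotient A c).map_surjective f'
    exact eq_of_homotopy _ _ (Homotopy.ofFan c (s := Fan.mk _ (Limits.Pi.π X))
      (fun n ↦ (Fan.isLimitMapConeEquiv (HomologicalComplex.eval A c n) _ _)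
        (isLimitOfPreserves _ (productIsProduct X)))
      fun i ↦ homotopyOfEq _ _ (by rw [Functor.map_comp, Functor.map_comp]; exact h i))

instance hasCoproductsOfShape [HasColimitsOfShape (Discrete I) A] :
    HasColimitsOfShape (Discrete I) (HomotopyCategory A c) :=
  hasCoproductsOfShape_of_essSurj (L := quotient A c)

instance hasProductsOfShape [HasLimitsOfShape (Discrete I) A] :
    HasLimitsOfShape (Discrete I) (HomotopyCategory A c) :=
  hasProductsOfShape_of_essSurj (L := quotient A c)

instance preservesCoproductsOfShape_homologyFunctor [HasColimitsOfShape (Discrete I) A]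
    [HasExactColimitsOfShape (Discrete I) A] (n : ι) :
    PreservesColimitsOfShape (Discrete I) (homologyFunctor A c n) := by
  have := preservesColimitsOfShape_of_natIso (J := Discrete I) (homologyFunctorFactors A c n).symm
  exact preservesCoproductsOfShape_of_essSurj_comp (L := quotient A c) _

instance preservesProductsOfShape_homologyFunctor [HasLimitsOfShape (Discrete I) A]
    [HasExactLimitsOfShape (Discrete I) A] (n : ι) :
    PreservesLimitsOfShape (Discrete I) (homologyFunctor A c n) := by
  have := preservesLimitsOfShape_of_natIso (J := Discrete I) (homologyFunctorFactors A c n).symm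
  exact preservesProductsOfShape_of_essSurj_comp (L := quotient A c) _

/-- Exactness of coproducts enters here: homology turns the coproduct into a coproduct of
isomorphisms in each degree. -/
instance isStableUnderCoproductsOfShape_quasiIso [HasColimitsOfShape (Discrete I) A]
    [HasExactColimitsOfShape (Discrete I) A] :
    (quasiIso A c).IsStableUnderCoproductsOfShape I where
  condition X₁ X₂ c₁ c₂ h₁ h₂ f hf φ hφ n :=
    MorphismProperty.IsStableUnderColimitsOfShape.condition (W := MorphismProperty.isomorphisms A)
      _ _ _ _ (isColimitOfPreserves (homologyFunctor A c n) h₁)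
      (isColimitOfPreserves (homologyFunctor A c n) h₂)
      (Functor.whiskerRight f (homologyFunctor A c n)) (fun j ↦ hf j n) _
      (fun j ↦ by
        have := (homologyFunctor A c n).congr_map (hφ j)
        rwa [Functor.map_comp, Functor.map_comp] at this)

instance isStableUnderProductsOfShape_quasiIso [HasLimitsOfShape (Discrete I) A]
    [HasExactLimitsOfShape (Discrete I) A] :
    (quasiIso A c).IsStableUnderProductsOfShape I where
  condition X₁ X₂ c₁ c₂ h₁ h₂ f hf φ hφ n :=
    have := isStableUnderLimitsOfShape_isomorphisms A (Discrete I)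
    MorphismProperty.IsStableUnderLimitsOfShape.condition (W := MorphismProperty.isomorphisms A)
      _ _ _ _ (isLimitOfPreserves (homologyFunctor A c n) h₁)
      (isLimitOfPreserves (homologyFunctor A c n) h₂)
      (Functor.whiskerRight f (homologyFunctor A c n)) (fun j ↦ hf j n) _
      (fun j ↦ by
        have := (homologyFunctor A c n).congr_map (hφ j)
        rwa [Functor.map_comp, Functor.map_comp] at this)

end HomotopyCategory

/-! ### Coproducts and products in the derived category -/

namespace DerivedCategory

variable {A : Type u} [Category.{v} A] [Abelian A] [HasDerivedCategory.{w} A] (I : Type t)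

section Coproducts

variable [HasColimitsOfShape (Discrete I) A] [HasExactColimitsOfShape (Discrete I) A]

instance preservesCoproductsOfShape_Qh :
    PreservesColimitsOfShape (Discrete I) (Qh (C := A)) := by
  have : (HomotopyCategory.quasiIso A (ComplexShape.up ℤ)).HasRightCalculusOfFractions := by
    -- The calculus of fractions comes from viewing the localization as the Verdier quotient by
    -- acyclic complexes.
    rw [HomotopyCategory.quasiIso_eq_trW_subcategoryAcyclic]
    infer_instance
  exact Localization.preservesColimitsOfShape_discrete _
    (HomotopyCategory.quasiIso A (ComplexShape.up ℤ))

instance preservesCoproductsOfShape_Q : PreservesColimitsOfShape (Discrete I) (Q (C := A)) :=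
  preservesColimitsOfShape_of_natIso (quotientCompQhIso A)

instance hasCoproductsOfShape : HasColimitsOfShape (Discrete I) (DerivedCategory A) :=
  hasCoproductsOfShape_of_essSurj (L := Q)

instance preservesCoproductsOfShape_homologyFunctor (n : ℤ) :
    PreservesColimitsOfShape (Discrete I) (homologyFunctor A n) := by
  have := preservesColimitsOfShape_of_natIso (J := Discrete I) (homologyFunctorFactors A n).symm
  exact preservesCoproductsOfShape_of_essSurj_comp (L := Q) _

instance preservesCoproductsOfShape_singleFunctor (n : ℤ) :
    PreservesColimitsOfShape (Discrete I) (singleFunctor A n) :=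
  inferInstanceAs (PreservesColimitsOfShape (Discrete I)
    (HomologicalComplex.single A (ComplexShape.up ℤ) n ⋙ Q))

end Coproducts

section Products

variable [HasLimitsOfShape (Discrete I) A] [HasExactLimitsOfShape (Discrete I) A]

instance preservesProductsOfShape_Qh :
    PreservesLimitsOfShape (Discrete I) (Qh (C := A)) := by
  have : (HomotopyCategory.quasiIso A (ComplexShape.up ℤ)).HasLeftCalculusOfFractions := by
    rw [HomotopyCategory.quasiIso_eq_trW_subcategoryAcyclic]
    infer_instance
  exact Localization.preservesLimitsOfShape_discrete _
    (HomotopyCategory.quasiIso A (ComplexShape.up ℤ))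

instance preservesProductsOfShape_Q : PreservesLimitsOfShape (Discrete I) (Q (C := A)) :=
  preservesLimitsOfShape_of_natIso (quotientCompQhIso A)

instance hasProductsOfShape : HasLimitsOfShape (Discrete I) (DerivedCategory A) :=
  hasProductsOfShape_of_essSurj (L := Q)

instance preservesProductsOfShape_homologyFunctor (n : ℤ) :
    PreservesLimitsOfShape (Discrete I) (homologyFunctor A n) := by
  have := preservesLimitsOfShape_of_natIso (J := Discrete I) (homologyFunctorFactors A n).symm
  exact preservesProductsOfShape_of_essSurj_comp (L := Q) _

instance preservesProductsOfShape_singleFunctor (n : ℤ) :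
    PreservesLimitsOfShape (Discrete I) (singleFunctor A n) :=
  inferInstanceAs (PreservesLimitsOfShape (Discrete I)
    (HomologicalComplex.single A (ComplexShape.up ℤ) n ⋙ Q))

end Products

end DerivedCategory

/-! ### Coproducts and products of distinguished triangles -/

namespace CategoryTheory.Pretriangulated

variable {D : Type u} [Category.{v} D] [Preadditive D] [HasZeroObject D] [HasShift D ℤ]
  [∀ n : ℤ, (shiftFunctor D n).Additive] [Pretriangulated D] {I : Type t}

/-- The shift of a colimit cofan is a colimit cofan. -/
noncomputable def isColimitShiftCofan {X : I → D} {Y : D} {f : ∀ i, X i ⟶ Y}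
    (h : IsColimit (Cofan.mk Y f)) (n : ℤ) :
    IsColimit (Cofan.mk (Y⟦n⟧) fun i ↦ (f i)⟦n⟧') :=
  Cofan.isColimitMapCoconeEquiv (shiftFunctor D n) _ _ (isColimitOfPreserves _ h)

/-- The shift of a limit fan is a limit fan. -/
noncomputable def isLimitShiftFan {X : I → D} {Y : D} {f : ∀ i, Y ⟶ X i}
    (h : IsLimit (Fan.mk Y f)) (n : ℤ) :
    IsLimit (Fan.mk (Y⟦n⟧) fun i ↦ (f i)⟦n⟧') :=
  Fan.isLimitMapConeEquiv (shiftFunctor D n) _ _ (isLimitOfPreserves _ h)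

lemma hom_ext_of_isColimit_cofan {C : Type*} [Category* C] {X : I → C} {Y Z : C}
    {f : ∀ i, X i ⟶ Y} (h : IsColimit (Cofan.mk Y f)) {g g' : Y ⟶ Z}
    (hg : ∀ i, f i ≫ g = f i ≫ g') : g = g' :=
  Cofan.IsColimit.hom_ext h _ _ hg

lemma hom_ext_of_isLimit_fan {C : Type*} [Category* C] {X : I → C} {Y Z : C}
    {f : ∀ i, Y ⟶ X i} (h : IsLimit (Fan.mk Y f)) {g g' : Z ⟶ Y}
    (hg : ∀ i, g ≫ f i = g' ≫ f i) : g = g' :=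
  Fan.IsLimit.hom_ext h _ _ hg

lemma exists_desc_of_isColimit_cofan {C : Type*} [Category* C] {X : I → C} {Y Z : C}
    {f : ∀ i, X i ⟶ Y} (h : IsColimit (Cofan.mk Y f)) (g : ∀ i, X i ⟶ Z) :
    ∃ k : Y ⟶ Z, ∀ i, f i ≫ k = g i :=
  ⟨Cofan.IsColimit.desc h g, Cofan.IsColimit.fac h g⟩

lemma exists_lift_of_isLimit_fan {C : Type*} [Category* C] {X : I → C} {Y Z : C}
    {f : ∀ i, Y ⟶ X i} (h : IsLimit (Fan.mk Y f)) (g : ∀ i, Z ⟶ X i) :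
    ∃ k : Z ⟶ Y, ∀ i, k ≫ f i = g i :=
  ⟨Fan.IsLimit.lift h g, Fan.IsLimit.fac h g⟩

/-- A coproduct of distinguished triangles is distinguished. -/
lemma distinguished_of_isColimit_cofan (T : I → Triangle D) (hT : ∀ i, T i ∈ distTriang D)
    (S : Triangle D) (φ : ∀ i, T i ⟶ S)
    (h₁ : IsColimit (Cofan.mk S.obj₁ fun i ↦ (φ i).hom₁))
    (h₂ : IsColimit (Cofan.mk S.obj₂ fun i ↦ (φ i).hom₂))
    (h₃ : IsColimit (Cofan.mk S.obj₃ fun i ↦ (φ i).hom₃)) : S ∈ distTriang D := by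
  -- Complete the first map of `S` to a distinguished triangle and compare. The maps `ψ i` on third
  -- objects are not canonical, but they glue to some `c : S.obj₃ ⟶ Z`, and any such `c` will do.
  obtain ⟨Z, g, h, hT'⟩ := distinguished_cocone_triangle S.mor₁
  obtain ⟨ψ, hψ⟩ : ∃ ψ : ∀ i, (T i).obj₃ ⟶ Z, ∀ i, (T i).mor₂ ≫ ψ i = (φ i).hom₂ ≫ g ∧
      (T i).mor₃ ≫ (φ i).hom₁⟦(1 : ℤ)⟧' = ψ i ≫ h := by
    choose ψ hψ using fun i ↦ complete_distinguished_triangle_morphism _ _ (hT i) hT'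
      (φ i).hom₁ (φ i).hom₂ (φ i).comm₁
    exact ⟨ψ, hψ⟩
  have exact₂ (V : D) (f : S.obj₂ ⟶ V) (hf : S.mor₁ ≫ f = 0) : ∃ k : Z ⟶ V, f = g ≫ k :=
    Triangle.yoneda_exact₂ _ hT' f hf
  have exact₃ (V : D) (f : Z ⟶ V) (hf : g ≫ f = 0) : ∃ k : S.obj₁⟦(1 : ℤ)⟧ ⟶ V, f = h ≫ k :=
    Triangle.yoneda_exact₃ _ hT' f hf
  have h₀ : h ≫ S.mor₁⟦(1 : ℤ)⟧' = 0 := comp_distTriang_mor_zero₃₁ _ hT'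
  obtain ⟨c, hc⟩ := exists_desc_of_isColimit_cofan h₃ ψ
  have hc₂ : S.mor₂ ≫ c = g := hom_ext_of_isColimit_cofan h₂ fun i ↦ by
    rw [← (φ i).comm₂_assoc, hc, (hψ i).1]
  have hc₃ : S.mor₃ = c ≫ h := hom_ext_of_isColimit_cofan h₃ fun i ↦ by
    rw [← (φ i).comm₃, reassoc_of% hc, (hψ i).2]
  have h₁₂ : S.mor₁ ≫ S.mor₂ = 0 := hom_ext_of_isColimit_cofan h₁ fun i ↦ by
    rw [← (φ i).comm₁_assoc, ← (φ i).comm₂, comp_distTriang_mor_zero₁₂_assoc _ (hT i), zero_comp,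
      comp_zero]
  have hc' : IsIso c := by
    -- A five-lemma argument for `Hom(-, V)`. Exactness for `S` is not yet available: it is taken
    -- from each `T i`, and the resulting factorizations are glued by the universal properties.
    refine isIso_of_coyoneda_map_bijective _ fun V ↦ ⟨?_, fun a ↦ ?_⟩
    · suffices Epi c by
        intro a₁ a₂ ha
        simpa only [← cancel_epi c] using ha
      rw [Preadditive.epi_iff_cancel_zero]
      intro V f hf
      obtain ⟨k, rfl⟩ := exact₃ _ f (by rw [← hc₂, assoc, hf, comp_zero])
      have (i : I) : ∃ l : (T i).obj₂⟦(1 : ℤ)⟧ ⟶ V, (φ i).hom₁⟦(1 : ℤ)⟧' ≫ k =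
          (T i).mor₁⟦(1 : ℤ)⟧' ≫ l := by
        obtain ⟨l, hl⟩ := Triangle.yoneda_exact₃ _ (rot_of_distTriang _ (hT i))
          ((φ i).hom₁⟦(1 : ℤ)⟧' ≫ k)
          (show (T i).mor₃ ≫ (φ i).hom₁⟦(1 : ℤ)⟧' ≫ k = 0 by
            rw [(φ i).comm₃_assoc, hc₃, assoc, hf, comp_zero])
        -- Rotating the triangle negates the shifted first map; the sign is absorbed into `l`.
        exact ⟨-l, hl.trans ((Preadditive.neg_comp _ _).trans (Preadditive.comp_neg _ _).symm)⟩
      choose l hl using this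
      obtain ⟨l', hl'⟩ := exists_desc_of_isColimit_cofan (isColimitShiftCofan h₂ 1) l
      have : k = S.mor₁⟦(1 : ℤ)⟧' ≫ l' :=
        hom_ext_of_isColimit_cofan (isColimitShiftCofan h₁ 1) fun i ↦ by
          rw [hl, ← hl', ← Functor.map_comp_assoc, (φ i).comm₁, Functor.map_comp_assoc]
      rw [this, reassoc_of% h₀, zero_comp]
    · obtain ⟨f, hf⟩ := exact₂ _ (S.mor₂ ≫ a)
        (by rw [reassoc_of% h₁₂, zero_comp])
      -- The error `a - c ≫ f` vanishes after `S.mor₂`, so on each summand it factors through the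
      -- connecting map; the glued factorization corrects `f`.
      have (i : I) := Triangle.yoneda_exact₃ _ (hT i) ((φ i).hom₃ ≫ (a - c ≫ f)) (by
        rw [(φ i).comm₂_assoc, Preadditive.comp_sub, hf, reassoc_of% hc₂, sub_self, comp_zero])
      choose b hb using this
      obtain ⟨b', hb'⟩ := exists_desc_of_isColimit_cofan (isColimitShiftCofan h₁ 1) b
      have : a - c ≫ f = S.mor₃ ≫ b' := hom_ext_of_isColimit_cofan h₃ fun i ↦ by
        rw [hb, ← hb', (φ i).comm₃_assoc]
      refine ⟨f + h ≫ b', ?_⟩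
      change c ≫ (f + h ≫ b') = a
      rw [Preadditive.comp_add, ← assoc, ← hc₃, ← this, add_sub_cancel]
  exact isomorphic_distinguished _ hT' _ (Triangle.isoMk S (Triangle.mk S.mor₁ g h)
    (Iso.refl _) (Iso.refl _) (@asIso _ _ _ _ c hc') ((comp_id _).trans (id_comp _).symm)
    (hc₂.trans (id_comp _).symm)
    (((congrArg _ (CategoryTheory.Functor.map_id _ _)).trans (comp_id _)).trans hc₃))

/-- A product of distinguished triangles is distinguished. -/
lemma distinguished_of_isLimit_fan (T : I → Triangle D) (hT : ∀ i, T i ∈ distTriang D)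
    (S : Triangle D) (φ : ∀ i, S ⟶ T i)
    (h₁ : IsLimit (Fan.mk S.obj₁ fun i ↦ (φ i).hom₁))
    (h₂ : IsLimit (Fan.mk S.obj₂ fun i ↦ (φ i).hom₂))
    (h₃ : IsLimit (Fan.mk S.obj₃ fun i ↦ (φ i).hom₃)) : S ∈ distTriang D := by
  have : HasProduct (fun i ↦ (T i).obj₁) := ⟨⟨_, h₁⟩⟩
  have : HasProduct (fun i ↦ (T i).obj₂) := ⟨⟨_, h₂⟩⟩
  have : HasProduct (fun i ↦ (T i).obj₃) := ⟨⟨_, h₃⟩⟩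
  have : HasProduct (fun i ↦ (T i).obj₁⟦(1 : ℤ)⟧) := ⟨⟨_, isLimitShiftFan h₁ 1⟩⟩
  have isIso_lift {X : I → D} [HasProduct X] {Y : D} {f : ∀ i, Y ⟶ X i}
      (h : IsLimit (Fan.mk Y f)) : IsIso (Limits.Pi.lift f) := by
    have : Limits.Pi.lift f = (h.conePointUniqueUpToIso (productIsProduct X)).hom :=
      Limits.Pi.hom_ext _ _ fun i ↦
        (Limits.Pi.lift_π _ _).trans
          (h.conePointUniqueUpToIso_hom_comp (productIsProduct X) ⟨i⟩).symm
    rw [this]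
    exact inferInstanceAs (IsIso (Iso.hom _))
  -- The comparison with the triangle built from the chosen products is an isomorphism at each
  -- vertex, since both sides are products.
  have := Triangle.isIso_of_isIsos (productTriangle.lift T φ) (isIso_lift h₁) (isIso_lift h₂)
    (isIso_lift h₃)
  exact isomorphic_distinguished _ (productTriangle_distinguished T hT) S
    (asIso (productTriangle.lift T φ))

end CategoryTheory.Pretriangulated

/-! ### Coproducts in extension-closed subcategories -/

namespace ExtriangulatedStructure

section

variable {D : Type u} [Category.{v} D] (P : ObjectProperty D) {I : Type t}

/-- The cofan in `D` given by a coproduct in a full subcategory closed under coproducts. -/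
noncomputable def isColimitAmbientCofan [HasColimitsOfShape (Discrete I) D]
    [P.IsClosedUnderColimitsOfShape (Discrete I)] (B : I → P.FullSubcategory) :
    IsColimit (Cofan.mk (∐ B).obj fun i ↦ (Limits.Sigma.ι B i).hom) :=
  Cofan.isColimitMapCoconeEquiv P.ι _ _ (isColimitOfPreserves P.ι (coproductIsCoproduct B))

/-- The fan in `D` given by a coproduct in the opposite of a full subcategory closed under
products. -/
noncomputable def isLimitAmbientFan [HasLimitsOfShape (Discrete I) D]
    [P.IsClosedUnderLimitsOfShape (Discrete I)] (B : I → P.FullSubcategoryᵒᵖ) :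
    IsLimit (Fan.mk (∐ B).unop.obj fun i ↦ (Limits.Sigma.ι B i).unop.hom) := by
  have h : IsLimit (Fan.mk (∐ B).unop fun i ↦ (Limits.Sigma.ι B i).unop) :=
    Fan.IsLimit.mk _ (fun s ↦ (Limits.Sigma.desc fun i ↦ (s.proj i).op).unop)
      (fun s i ↦ congrArg Quiver.Hom.unop
        (Limits.Sigma.ι_desc (f := B) (fun i ↦ (s.proj i).op) i))
      (fun s m hm ↦ congrArg Quiver.Hom.unop
        (Limits.Sigma.hom_ext (f := B) m.op (Limits.Sigma.desc fun i ↦ (s.proj i).op) fun i ↦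
          (congrArg Quiver.Hom.op (hm i)).trans
            (Limits.Sigma.ι_desc (f := B) (fun i ↦ (s.proj i).op) i).symm))
  exact Fan.isLimitMapConeEquiv P.ι _ _ (isLimitOfPreserves P.ι h)

lemma ι_map_hom [HasColimitsOfShape (Discrete I) D]
    [P.IsClosedUnderColimitsOfShape (Discrete I)] {B B' : I → P.FullSubcategory}
    (f : ∀ i, B i ⟶ B' i) (i : I) :
    (Limits.Sigma.ι B i).hom ≫ (Limits.Sigma.map f).hom =
      (f i).hom ≫ (Limits.Sigma.ι B' i).hom :=
  congrArg InducedCategory.Hom.hom (Limits.Sigma.ι_map f i)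

lemma map_unop_hom_π [HasLimitsOfShape (Discrete I) D]
    [P.IsClosedUnderLimitsOfShape (Discrete I)] {B B' : I → P.FullSubcategoryᵒᵖ}
    (f : ∀ i, B i ⟶ B' i) (i : I) :
    (Limits.Sigma.map f).unop.hom ≫ (Limits.Sigma.ι B i).unop.hom =
      (Limits.Sigma.ι B' i).unop.hom ≫ (f i).unop.hom :=
  congrArg (fun g ↦ g.unop.hom) (Limits.Sigma.ι_map f i)

variable [HasShift D ℤ]

/-- The coproduct of a family of extensions in a subcategory closed under coproducts. -/
noncomputable def sigmaExt [HasColimitsOfShape (Discrete I) D]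
    [P.IsClosedUnderColimitsOfShape (Discrete I)] {B : I → P.FullSubcategory}
    {A : P.FullSubcategory} (η : ∀ i, (B i).obj ⟶ A.obj⟦(1 : ℤ)⟧) :
    (∐ B).obj ⟶ (∐ fun _ : I ↦ A).obj⟦(1 : ℤ)⟧ :=
  Cofan.IsColimit.desc (isColimitAmbientCofan P B)
    fun i ↦ η i ≫ (Limits.Sigma.ι (fun _ : I ↦ A) i).hom⟦(1 : ℤ)⟧'

lemma ι_sigmaExt [HasColimitsOfShape (Discrete I) D]
    [P.IsClosedUnderColimitsOfShape (Discrete I)] {B : I → P.FullSubcategory}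
    {A : P.FullSubcategory} (η : ∀ i, (B i).obj ⟶ A.obj⟦(1 : ℤ)⟧) (i : I) :
    (Limits.Sigma.ι B i).hom ≫ sigmaExt P η =
      η i ≫ (Limits.Sigma.ι (fun _ : I ↦ A) i).hom⟦(1 : ℤ)⟧' :=
  Cofan.IsColimit.fac (isColimitAmbientCofan P B) _ i

lemma sigmaExt_comp [HasColimitsOfShape (Discrete I) D]
    [P.IsClosedUnderColimitsOfShape (Discrete I)] {B B' : I → P.FullSubcategory}
    (f : ∀ i, B' i ⟶ B i) {A : P.FullSubcategory} (η : ∀ i, (B i).obj ⟶ A.obj⟦(1 : ℤ)⟧) :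
    sigmaExt P (fun i ↦ (f i).hom ≫ η i) = (Limits.Sigma.map f).hom ≫ sigmaExt P η :=
  hom_ext_of_isColimit_cofan (isColimitAmbientCofan P B') fun i ↦ by
    rw [reassoc_of% ι_map_hom P, ι_sigmaExt, ι_sigmaExt, assoc]

lemma sigmaExt_comp_shift [HasColimitsOfShape (Discrete I) D]
    [P.IsClosedUnderColimitsOfShape (Discrete I)] {B : I → P.FullSubcategory}
    {A A' : P.FullSubcategory} (g : A ⟶ A') (η : ∀ i, (B i).obj ⟶ A.obj⟦(1 : ℤ)⟧) :
    sigmaExt P (fun i ↦ η i ≫ g.hom⟦(1 : ℤ)⟧') =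
      sigmaExt P η ≫ (Limits.Sigma.map fun _ : I ↦ g).hom⟦(1 : ℤ)⟧' :=
  hom_ext_of_isColimit_cofan (isColimitAmbientCofan P B) fun i ↦ by
    rw [ι_sigmaExt, reassoc_of% ι_sigmaExt P, assoc, ← Functor.map_comp, ← Functor.map_comp,
      ι_map_hom]

/-- The product of a family of extensions in a subcategory closed under products. -/
noncomputable def piExt [HasLimitsOfShape (Discrete I) D]
    [P.IsClosedUnderLimitsOfShape (Discrete I)] {B : I → P.FullSubcategoryᵒᵖ}
    {A : P.FullSubcategoryᵒᵖ} (η : ∀ i, A.unop.obj ⟶ (B i).unop.obj⟦(1 : ℤ)⟧) :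
    (∐ fun _ : I ↦ A).unop.obj ⟶ (∐ B).unop.obj⟦(1 : ℤ)⟧ :=
  Fan.IsLimit.lift (isLimitShiftFan (isLimitAmbientFan P B) 1)
    fun i ↦ (Limits.Sigma.ι (fun _ : I ↦ A) i).unop.hom ≫ η i

lemma piExt_π [HasLimitsOfShape (Discrete I) D]
    [P.IsClosedUnderLimitsOfShape (Discrete I)] {B : I → P.FullSubcategoryᵒᵖ}
    {A : P.FullSubcategoryᵒᵖ} (η : ∀ i, A.unop.obj ⟶ (B i).unop.obj⟦(1 : ℤ)⟧) (i : I) :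
    piExt P η ≫ (Limits.Sigma.ι B i).unop.hom⟦(1 : ℤ)⟧' =
      (Limits.Sigma.ι (fun _ : I ↦ A) i).unop.hom ≫ η i :=
  Fan.IsLimit.fac (isLimitShiftFan (isLimitAmbientFan P B) 1) _ i

lemma piExt_comp [HasLimitsOfShape (Discrete I) D]
    [P.IsClosedUnderLimitsOfShape (Discrete I)] {B : I → P.FullSubcategoryᵒᵖ}
    {A A' : P.FullSubcategoryᵒᵖ} (g : A ⟶ A')
    (η : ∀ i, A.unop.obj ⟶ (B i).unop.obj⟦(1 : ℤ)⟧) :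
    piExt P (fun i ↦ g.unop.hom ≫ η i) =
      (Limits.Sigma.map fun _ : I ↦ g).unop.hom ≫ piExt P η :=
  hom_ext_of_isLimit_fan (isLimitShiftFan (isLimitAmbientFan P B) 1) fun i ↦ by
    rw [piExt_π, assoc, piExt_π, reassoc_of% map_unop_hom_π P]

lemma piExt_comp_shift [HasLimitsOfShape (Discrete I) D]
    [P.IsClosedUnderLimitsOfShape (Discrete I)] {B B' : I → P.FullSubcategoryᵒᵖ}
    (f : ∀ i, B' i ⟶ B i) {A : P.FullSubcategoryᵒᵖ}
    (η : ∀ i, A.unop.obj ⟶ (B i).unop.obj⟦(1 : ℤ)⟧) :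
    piExt P (fun i ↦ η i ≫ (f i).unop.hom⟦(1 : ℤ)⟧') =
      piExt P η ≫ (Limits.Sigma.map f).unop.hom⟦(1 : ℤ)⟧' :=
  hom_ext_of_isLimit_fan (isLimitShiftFan (isLimitAmbientFan P B') 1) fun i ↦ by
    rw [piExt_π, assoc, ← Functor.map_comp, map_unop_hom_π, Functor.map_comp, reassoc_of% piExt_π P]

variable [Preadditive D] [HasZeroObject D] [∀ n : ℤ, (shiftFunctor D n).Additive]
  [Pretriangulated D] [IsTriangulated D] [P.IsClosedUnderIsomorphisms]
  [P.IsTriangulatedClosed₂] [P.ContainsZero]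

variable (I) in
/-- The coproduct of extensions in an extension-closed subcategory closed under coproducts. -/
noncomputable def coproductExtensionOfClosed [HasColimitsOfShape (Discrete I) D]
    [P.IsClosedUnderColimitsOfShape (Discrete I)] :
    (ofExtensionClosed P).CoproductExtension I where
  Γ B _ := AddMonoidHom.mk' (fun η ↦ sigmaExt P η) fun η η' ↦
    hom_ext_of_isColimit_cofan (isColimitAmbientCofan P B) fun i ↦
      (ι_sigmaExt P _ i).trans ((Preadditive.add_comp _ _ _ _ _ _).trans
        ((congrArg₂ (· + ·) (ι_sigmaExt P η i) (ι_sigmaExt P η' i)).symm.trans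
          (Preadditive.comp_add _ _ _ _ _ _).symm))
  pull_Γ f _ η := sigmaExt_comp P f η
  push_Γ g η := sigmaExt_comp_shift P g η
  realizes_Γ {B E A} η f g h := distinguished_of_isColimit_cofan
    (fun i ↦ Triangle.mk (f i).hom (g i).hom (η i)) h _
    (fun i ↦ Triangle.homMk _ _ (Limits.Sigma.ι (fun _ : I ↦ A) i).hom (Limits.Sigma.ι E i).hom
      (Limits.Sigma.ι B i).hom (ι_map_hom P f i).symm (ι_map_hom P g i).symm
      (ι_sigmaExt P η i).symm)
    (isColimitAmbientCofan P _) (isColimitAmbientCofan P _) (isColimitAmbientCofan P _)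

/-- The compatibility with inclusions demanded by AET4 is the defining equation of `sigmaExt`. -/
lemma isAET4_ofExtensionClosed [∀ I : Type t, HasColimitsOfShape (Discrete I) D]
    [∀ I : Type t, P.IsClosedUnderColimitsOfShape (Discrete I)] :
    (ofExtensionClosed P).IsAET4.{t} := fun I _ ↦
  ⟨inferInstance, coproductExtensionOfClosed P I, fun _ _ η i ↦ ι_sigmaExt P η i⟩

variable (I) in
/-- The product of extensions in an extension-closed subcategory closed under products. -/
noncomputable def productExtensionOfClosed [HasLimitsOfShape (Discrete I) D]
    [P.IsClosedUnderLimitsOfShape (Discrete I)] :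
    (ofExtensionClosed P).op.CoproductExtension I where
  Γ B _ := AddMonoidHom.mk' (fun η ↦ piExt P η) fun η η' ↦
    hom_ext_of_isLimit_fan (isLimitShiftFan (isLimitAmbientFan P B) 1) fun i ↦
      (piExt_π P _ i).trans ((Preadditive.comp_add _ _ _ _ _ _).trans
        ((congrArg₂ (· + ·) (piExt_π P η i) (piExt_π P η' i)).symm.trans
          (Preadditive.add_comp _ _ _ _ _ _).symm))
  pull_Γ f _ η := piExt_comp_shift P f η
  push_Γ g η := piExt_comp P g η
  -- Passing to the opposite reverses the sequences: in `D` the triangles start at `B i`, and the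
  -- constant object `A` is the third term.
  realizes_Γ {B E A} η f g h := distinguished_of_isLimit_fan
    (fun i ↦ Triangle.mk (g i).unop.hom (f i).unop.hom (η i)) h _
    (fun i ↦ Triangle.homMk _ _ (Limits.Sigma.ι B i).unop.hom (Limits.Sigma.ι E i).unop.hom
      (Limits.Sigma.ι (fun _ : I ↦ A) i).unop.hom (map_unop_hom_π P g i) (map_unop_hom_π P f i)
      (piExt_π P η i))
    (isLimitAmbientFan P _) (isLimitAmbientFan P _) (isLimitAmbientFan P _)

lemma isAET4Star_ofExtensionClosed [∀ I : Type t, HasLimitsOfShape (Discrete I) D]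
    [∀ I : Type t, P.IsClosedUnderLimitsOfShape (Discrete I)] :
    (ofExtensionClosed P).IsAET4Star.{t} := fun I _ ↦
  ⟨inferInstance, productExtensionOfClosed P I, fun _ _ η i ↦ piExt_π P η i⟩

end

end ExtriangulatedStructure

/-! ### Closure under coproducts and products -/

namespace CategoryTheory.ObjectProperty

section

variable {C : Type u} [Category.{v} C] {P Q : ObjectProperty C} {I : Type t}

lemma isClosedUnderCoproductsOfShape_of_cofan
    (h : ∀ (X : I → C) (Y : C) (f : ∀ i, X i ⟶ Y), IsColimit (Cofan.mk Y f) →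
      (∀ i, P (X i)) → P Y) : P.IsClosedUnderColimitsOfShape (Discrete I) where
  colimitsOfShape_le := by
    rintro Y ⟨p⟩
    exact h (fun i ↦ p.diag.obj ⟨i⟩) Y (fun i ↦ p.ι.app ⟨i⟩)
      (Cofan.IsColimit.mk _
        (fun s ↦ p.isColimit.desc (Cocone.mk s.pt (Discrete.natTrans fun i ↦ s.inj i.as)))
        (fun s i ↦ p.isColimit.fac (Cocone.mk s.pt (Discrete.natTrans fun i ↦ s.inj i.as)) ⟨i⟩)
        (fun s m hm ↦ p.isColimit.hom_ext fun i ↦ (hm i.as).trans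
          (p.isColimit.fac (Cocone.mk s.pt (Discrete.natTrans fun i ↦ s.inj i.as)) i).symm))
      (fun i ↦ p.prop_diag_obj ⟨i⟩)

lemma isClosedUnderProductsOfShape_of_fan
    (h : ∀ (X : I → C) (Y : C) (f : ∀ i, Y ⟶ X i), IsLimit (Fan.mk Y f) →
      (∀ i, P (X i)) → P Y) : P.IsClosedUnderLimitsOfShape (Discrete I) where
  limitsOfShape_le := by
    rintro Y ⟨p⟩
    exact h (fun i ↦ p.diag.obj ⟨i⟩) Y (fun i ↦ p.π.app ⟨i⟩)
      (Fan.IsLimit.mk _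
        (fun s ↦ p.isLimit.lift (Cone.mk s.pt (Discrete.natTrans fun i ↦ s.proj i.as)))
        (fun s i ↦ p.isLimit.fac (Cone.mk s.pt (Discrete.natTrans fun i ↦ s.proj i.as)) ⟨i⟩)
        (fun s m hm ↦ p.isLimit.hom_ext fun i ↦ (hm i.as).trans
          (p.isLimit.fac (Cone.mk s.pt (Discrete.natTrans fun i ↦ s.proj i.as)) i).symm))
      (fun i ↦ p.prop_diag_obj ⟨i⟩)

lemma prop_of_isColimit_cofanMk [P.IsClosedUnderColimitsOfShape (Discrete I)] {X : I → C} {Y : C}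
    {f : ∀ i, X i ⟶ Y} (h : IsColimit (Cofan.mk Y f)) (hX : ∀ i, P (X i)) : P Y :=
  P.prop_of_isColimit h fun i ↦ hX i.as

lemma prop_of_isLimit_fanMk [P.IsClosedUnderLimitsOfShape (Discrete I)] {X : I → C} {Y : C}
    {f : ∀ i, Y ⟶ X i} (h : IsLimit (Fan.mk Y f)) (hX : ∀ i, P (X i)) : P Y :=
  P.prop_of_isLimit h fun i ↦ hX i.as

instance isClosedUnderColimitsOfShape_inf {J : Type*} [Category* J]
    [P.IsClosedUnderColimitsOfShape J] [Q.IsClosedUnderColimitsOfShape J] :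
    (P ⊓ Q).IsClosedUnderColimitsOfShape J where
  colimitsOfShape_le _ h := ⟨P.colimitsOfShape_le J _ (colimitsOfShape_monotone J inf_le_left _ h),
    Q.colimitsOfShape_le J _ (colimitsOfShape_monotone J inf_le_right _ h)⟩

instance isClosedUnderLimitsOfShape_inf {J : Type*} [Category* J]
    [P.IsClosedUnderLimitsOfShape J] [Q.IsClosedUnderLimitsOfShape J] :
    (P ⊓ Q).IsClosedUnderLimitsOfShape J where
  limitsOfShape_le _ h := ⟨P.limitsOfShape_le J _ (limitsOfShape_monotone J inf_le_left _ h),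
    Q.limitsOfShape_le J _ (limitsOfShape_monotone J inf_le_right _ h)⟩

variable {D : Type*} [Category* D]

lemma isClosedUnderCoproductsOfShape_map [HasColimitsOfShape (Discrete I) C]
    [P.IsClosedUnderColimitsOfShape (Discrete I)] (F : C ⥤ D)
    [PreservesColimitsOfShape (Discrete I) F] :
    (P.map F).IsClosedUnderColimitsOfShape (Discrete I) :=
  isClosedUnderCoproductsOfShape_of_cofan fun X Y f h hX ↦ by
    choose A hA e using hX
    have h' := Cofan.isColimitMapCoconeEquiv F _ _ (isColimitOfPreserves F (coproductIsCoproduct A))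
    exact ⟨∐ A, prop_of_isColimit_cofanMk (coproductIsCoproduct A) hA,
      ⟨h'.coconePointsIsoOfNatIso h (Discrete.natIso fun i ↦ (e i.as).some)⟩⟩

lemma isClosedUnderProductsOfShape_map [HasLimitsOfShape (Discrete I) C]
    [P.IsClosedUnderLimitsOfShape (Discrete I)] (F : C ⥤ D)
    [PreservesLimitsOfShape (Discrete I) F] :
    (P.map F).IsClosedUnderLimitsOfShape (Discrete I) :=
  isClosedUnderProductsOfShape_of_fan fun X Y f h hX ↦ by
    choose A hA e using hX
    have h' := Fan.isLimitMapConeEquiv F _ _ (isLimitOfPreserves F (productIsProduct A))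
    exact ⟨∏ᶜ A, prop_of_isLimit_fanMk (productIsProduct A) hA,
      ⟨h'.conePointsIsoOfNatIso h (Discrete.natIso fun i ↦ (e i.as).some)⟩⟩

end

section

variable {D : Type u} [Category.{v} D] [Preadditive D] [HasZeroObject D] [HasShift D ℤ]
  [∀ n : ℤ, (shiftFunctor D n).Additive] [Pretriangulated D] (P Q : ObjectProperty D) {I : Type t}

instance isClosedUnderColimitsOfShape_shift {J : Type*} [Category* J]
    [P.IsClosedUnderColimitsOfShape J] (n : ℤ) :
    (P.shift n).IsClosedUnderColimitsOfShape J :=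
  inferInstanceAs ((P.inverseImage (shiftFunctor D n)).IsClosedUnderColimitsOfShape J)

instance isClosedUnderLimitsOfShape_shift {J : Type*} [Category* J]
    [P.IsClosedUnderLimitsOfShape J] (n : ℤ) :
    (P.shift n).IsClosedUnderLimitsOfShape J :=
  inferInstanceAs ((P.inverseImage (shiftFunctor D n)).IsClosedUnderLimitsOfShape J)

/-- The coproduct of the chosen triangles is distinguished. The given colimit `Y` is used as its
middle term, so no transport along an isomorphism is needed. -/
lemma isClosedUnderCoproductsOfShape_extensionProduct [HasColimitsOfShape (Discrete I) D]
    [P.IsClosedUnderColimitsOfShape (Discrete I)] [Q.IsClosedUnderColimitsOfShape (Discrete I)] :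
    (P.extensionProduct Q).IsClosedUnderColimitsOfShape (Discrete I) :=
  isClosedUnderCoproductsOfShape_of_cofan fun X Y ι hι hX ↦ by
    choose A B f g h mem hA hB using hX
    have hA' := coproductIsCoproduct A
    have hB' := coproductIsCoproduct B
    obtain ⟨f', hf⟩ := exists_desc_of_isColimit_cofan hA' fun i ↦ f i ≫ ι i
    obtain ⟨g', hg⟩ := exists_desc_of_isColimit_cofan hι fun i ↦ g i ≫ Limits.Sigma.ι B i
    obtain ⟨h', hh⟩ := exists_desc_of_isColimit_cofan hB'
      fun i ↦ h i ≫ (Limits.Sigma.ι A i)⟦(1 : ℤ)⟧'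
    exact ⟨_, _, f', g', h', distinguished_of_isColimit_cofan _ mem (Triangle.mk f' g' h')
      (fun i ↦ Triangle.homMk _ (Triangle.mk f' g' h') (Limits.Sigma.ι A i) (ι i)
        (Limits.Sigma.ι B i) (hf i).symm (hg i).symm (hh i).symm) hA' hι hB',
      prop_of_isColimit_cofanMk hA' hA, prop_of_isColimit_cofanMk hB' hB⟩

lemma isClosedUnderProductsOfShape_extensionProduct [HasLimitsOfShape (Discrete I) D]
    [P.IsClosedUnderLimitsOfShape (Discrete I)] [Q.IsClosedUnderLimitsOfShape (Discrete I)] :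
    (P.extensionProduct Q).IsClosedUnderLimitsOfShape (Discrete I) :=
  isClosedUnderProductsOfShape_of_fan fun X Y π hπ hX ↦ by
    choose A B f g h mem hA hB using hX
    have hA' := productIsProduct A
    have hB' := productIsProduct B
    obtain ⟨f', hf⟩ := exists_lift_of_isLimit_fan hπ fun i ↦ Limits.Pi.π A i ≫ f i
    obtain ⟨g', hg⟩ := exists_lift_of_isLimit_fan hB' fun i ↦ π i ≫ g i
    obtain ⟨h', hh⟩ := exists_lift_of_isLimit_fan (isLimitShiftFan hA' 1)
      fun i ↦ Limits.Pi.π B i ≫ h i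
    exact ⟨_, _, f', g', h', distinguished_of_isLimit_fan _ mem (Triangle.mk f' g' h')
      (fun i ↦ Triangle.homMk (Triangle.mk f' g' h') _ (Limits.Pi.π A i) (π i)
        (Limits.Pi.π B i) (hf i) (hg i) (hh i)) hA' hπ hB',
      prop_of_isLimit_fanMk hA' hA, prop_of_isLimit_fanMk hB' hB⟩

end

end CategoryTheory.ObjectProperty

/-! ### Coproducts and products in aisles, coaisles and extended hearts -/

namespace CategoryTheory.Triangulated.TStructure

variable {D : Type u} [Category.{v} D] [Preadditive D] [HasZeroObject D] [HasShift D ℤ]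
  [∀ n : ℤ, (shiftFunctor D n).Additive] [Pretriangulated D] (x : TStructure D)
  (I : Type t)

/-- An aisle is a left orthogonal, and a map out of a coproduct vanishes as soon as its restrictions
do; no smashing hypothesis is involved. -/
instance isClosedUnderCoproductsOfShape_le (n : ℤ) :
    (x.le n).IsClosedUnderColimitsOfShape (Discrete I) :=
  ObjectProperty.isClosedUnderCoproductsOfShape_of_cofan fun X Y f h hX ↦ by
    rw [le_iff_isLE, x.isLE_iff_orthogonal n (n + 1) rfl]
    exact fun Z g _ ↦ hom_ext_of_isColimit_cofan h fun i ↦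
      (x.zero_of_isLE_of_isGE (f i ≫ g) n (n + 1) (by lia) ⟨hX i⟩ inferInstance).trans
        comp_zero.symm

instance isClosedUnderProductsOfShape_ge (n : ℤ) :
    (x.ge n).IsClosedUnderLimitsOfShape (Discrete I) :=
  ObjectProperty.isClosedUnderProductsOfShape_of_fan fun X Y f h hX ↦ by
    rw [ge_iff_isGE, x.isGE_iff_orthogonal (n - 1) n (by lia)]
    exact fun Z g _ ↦ hom_ext_of_isLimit_fan h fun i ↦
      (x.zero_of_isLE_of_isGE (g ≫ f i) (n - 1) n (by lia) inferInstance ⟨hX i⟩).trans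
        zero_comp.symm

variable {x}

/-- The extended heart of a smashing t-structure is closed under coproducts. -/
lemma IsSmashing.isClosedUnderCoproductsOfShape_extendedHeart
    (h : x.IsSmashing.{t}) : x.extendedHeart.IsClosedUnderColimitsOfShape (Discrete I) := by
  have := h I
  rw [extendedHeart_eq]
  infer_instance

/-- The extended heart of a co-smashing t-structure is closed under products. -/
lemma IsCoSmashing.isClosedUnderProductsOfShape_extendedHeart
    (h : x.IsCoSmashing.{t}) : x.extendedHeart.IsClosedUnderLimitsOfShape (Discrete I) := by
  have := h I
  -- Co-smashing concerns `x.le 0`, while the extended heart involves `x.le 1`; the two differ by a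
  -- shift.
  have : (x.le 1).IsClosedUnderLimitsOfShape (Discrete I) := by
    rw [← x.shift_le 1 0 1 (by lia)]
    infer_instance
  rw [extendedHeart_eq]
  infer_instance

variable [IsTriangulated D]

lemma IsSmashing.isAET4 [∀ I : Type t, HasColimitsOfShape (Discrete I) D]
    (h : x.IsSmashing.{t}) : x.extendedHeartExtriangulated.IsAET4.{t} :=
  have := fun I : Type t ↦ h.isClosedUnderCoproductsOfShape_extendedHeart I
  ExtriangulatedStructure.isAET4_ofExtensionClosed x.extendedHeart

lemma IsCoSmashing.isAET4Star [∀ I : Type t, HasLimitsOfShape (Discrete I) D]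
    (h : x.IsCoSmashing.{t}) : x.extendedHeartExtriangulated.IsAET4Star.{t} :=
  have := fun I : Type t ↦ h.isClosedUnderProductsOfShape_extendedHeart I
  ExtriangulatedStructure.isAET4Star_ofExtensionClosed x.extendedHeart

end CategoryTheory.Triangulated.TStructure

namespace DerivedCategory

variable {A : Type u} [Category.{v} A] [Abelian A] [HasDerivedCategory.{w} A] (I : Type t)

/-- The standard coaisle is detected by vanishing of homology, which commutes with coproducts under
exactness. -/
instance isClosedUnderCoproductsOfShape_ge [HasColimitsOfShape (Discrete I) A]
    [HasExactColimitsOfShape (Discrete I) A] (n : ℤ) :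
    ((TStructure.t (C := A)).ge n).IsClosedUnderColimitsOfShape (Discrete I) :=
  ObjectProperty.isClosedUnderCoproductsOfShape_of_cofan fun X Y f h hX ↦ by
    rw [TStructure.ge_iff_isGE]
    refine (isGE_iff Y n).2 fun i hi ↦ ?_
    rw [IsZero.iff_id_eq_zero]
    refine hom_ext_of_isColimit_cofan (Cofan.isColimitMapCoconeEquiv (homologyFunctor A i) _ _
      (isColimitOfPreserves _ h)) fun j ↦ ?_
    exact ((isGE_iff (X j) n).1 ⟨hX j⟩ i hi).eq_of_src _ _

instance isClosedUnderProductsOfShape_le [HasLimitsOfShape (Discrete I) A]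
    [HasExactLimitsOfShape (Discrete I) A] (n : ℤ) :
    ((TStructure.t (C := A)).le n).IsClosedUnderLimitsOfShape (Discrete I) :=
  ObjectProperty.isClosedUnderProductsOfShape_of_fan fun X Y f h hX ↦ by
    rw [TStructure.le_iff_isLE]
    refine (isLE_iff Y n).2 fun i hi ↦ ?_
    rw [IsZero.iff_id_eq_zero]
    refine hom_ext_of_isLimit_fan (Fan.isLimitMapConeEquiv (homologyFunctor A i) _ _
      (isLimitOfPreserves _ h)) fun j ↦ ?_
    exact ((isLE_iff (X j) n).1 ⟨hX j⟩ i hi).eq_of_tgt _ _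

end DerivedCategory

/-! ### From the torsion pair to the tilted t-structure -/

namespace TorsionPair

open DerivedCategory (singleFunctor)

variable {A : Type u} [Category.{v} A] [Abelian A] [HasDerivedCategory.{w} A] {𝒯 : TorsionPair A}

lemma IsSmashing.tilt [HasCoproducts.{t} A] [AB4OfSize.{t} A] (h : 𝒯.IsSmashing.{t}) :
    𝒯.tilt.IsSmashing.{t} := fun I ↦ by
  have := h I
  have := ObjectProperty.isClosedUnderCoproductsOfShape_map (I := I) (P := 𝒯.free)
    (singleFunctor A 0)
  rw [tilt_ge_zero]
  exact ObjectProperty.isClosedUnderCoproductsOfShape_extensionProduct _ _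

lemma IsCoSmashing.tilt [HasProducts.{t} A] [AB4StarOfSize.{t} A] (h : 𝒯.IsCoSmashing.{t}) :
    𝒯.tilt.IsCoSmashing.{t} := fun I ↦ by
  have := h I
  have := ObjectProperty.isClosedUnderProductsOfShape_map (I := I) (P := 𝒯.tors)
    (singleFunctor A 0)
  rw [tilt_le_zero]
  exact ObjectProperty.isClosedUnderProductsOfShape_extensionProduct _ _

end TorsionPair

/-! ### Coproduct extensions and torsion pairs -/

namespace ExtriangulatedStructure

section

variable {D : Type u} [Category.{v} D] {P : ObjectProperty D} {I : Type t}

/-- A cofan in a full subcategory is colimit if it is so in the ambient category. -/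
noncomputable def isColimitOfAmbientCofan {X : I → P.FullSubcategory} {Y : P.FullSubcategory}
    {f : ∀ i, X i ⟶ Y} (h : IsColimit (Cofan.mk Y.obj fun i ↦ (f i).hom)) :
    IsColimit (Cofan.mk Y f) :=
  Cofan.IsColimit.mk _ (fun s ↦ P.homMk (Cofan.IsColimit.desc h fun i ↦ (s.inj i).hom))
    (fun s i ↦ InducedCategory.hom_ext (Cofan.IsColimit.fac h (fun i ↦ (s.inj i).hom) i))
    (fun s _ hm ↦ InducedCategory.hom_ext (Cofan.IsColimit.hom_ext h _ _ fun i ↦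
      (congrArg InducedCategory.Hom.hom (hm i)).trans
        (Cofan.IsColimit.fac h (fun i ↦ (s.inj i).hom) i).symm))

/-- The opposite of a fan in a full subcategory is a colimit cofan if the fan is limit in the
ambient category. -/
noncomputable def isColimitOpOfAmbientFan {X : I → P.FullSubcategory} {Y : P.FullSubcategory}
    {f : ∀ i, Y ⟶ X i} (h : IsLimit (Fan.mk Y.obj fun i ↦ (f i).hom)) :
    IsColimit (Cofan.mk (Opposite.op Y) fun i ↦ (f i).op) :=
  Cofan.IsColimit.mk _ (fun s ↦ (P.homMk (Fan.IsLimit.lift h fun i ↦ (s.inj i).unop.hom)).op)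
    (fun s i ↦ Quiver.Hom.unop_inj
      (InducedCategory.hom_ext (Fan.IsLimit.fac h (fun i ↦ (s.inj i).unop.hom) i)))
    (fun s _ hm ↦ Quiver.Hom.unop_inj
      (InducedCategory.hom_ext (Fan.IsLimit.hom_ext h _ _ fun i ↦
        (congrArg (fun g ↦ g.unop.hom) (hm i)).trans
          (Fan.IsLimit.fac h (fun i ↦ (s.inj i).unop.hom) i).symm)))

end

section

variable {D : Type u} [Category.{v} D] [Preadditive D] [HasZeroObject D] [HasShift D ℤ]
  [∀ n : ℤ, (shiftFunctor D n).Additive] [Pretriangulated D] [IsTriangulated D]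
  {P : ObjectProperty D} [P.IsClosedUnderIsomorphisms] [P.IsTriangulatedClosed₂] [P.ContainsZero]
  {I : Type t}

/-- If an extension-closed subcategory is AET3.5, then a coproduct in the ambient category of
cones `B i` of morphisms `X ⟶ E i` belongs to the subcategory as soon as the coproducts of the
constant family `X` and of the family `E` do. -/
lemma IsAET35.prop_of_isColimit_cofan (hP : (ofExtensionClosed P).IsAET35.{t}) [Nonempty I]
    {X : D} {E B : I → D} (hX : P X) (hE : ∀ i, P (E i)) (hB : ∀ i, P (B i))
    (f : ∀ i, X ⟶ E i) (g : ∀ i, E i ⟶ B i) (η : ∀ i, B i ⟶ X⟦(1 : ℤ)⟧)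
    (mem : ∀ i, Triangle.mk (f i) (g i) (η i) ∈ distTriang D)
    {X' E' B' : D} {x : I → (X ⟶ X')} {e : ∀ i, E i ⟶ E'} {b : ∀ i, B i ⟶ B'}
    (hx : IsColimit (Cofan.mk X' x)) (he : IsColimit (Cofan.mk E' e))
    (hb : IsColimit (Cofan.mk B' b)) (hX' : P X') (hE' : P E') : P B' := by
  obtain ⟨_, ⟨G⟩⟩ := hP I
  obtain ⟨f', hf⟩ := exists_desc_of_isColimit_cofan hx fun i ↦ f i ≫ e i
  obtain ⟨g', hg⟩ := exists_desc_of_isColimit_cofan he fun i ↦ g i ≫ b i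
  obtain ⟨η', hη⟩ := exists_desc_of_isColimit_cofan hb fun i ↦ η i ≫ (x i)⟦(1 : ℤ)⟧'
  -- One of two triangles to be compared: the coproduct in `D`, with third object `B'`. The other,
  -- `mem₀`, is the coproduct in the subcategory supplied by AET3.5.
  have mem' : Triangle.mk f' g' η' ∈ distTriang D := distinguished_of_isColimit_cofan _ mem _
    (fun i ↦ Triangle.homMk _ (Triangle.mk f' g' η') (x i) (e i) (b i) (hf i).symm (hg i).symm
      (hη i).symm) hx he hb
  let X₀ : P.FullSubcategory := ⟨X, hX⟩
  let E₀ : I → P.FullSubcategory := fun i ↦ ⟨E i, hE i⟩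
  let B₀ : I → P.FullSubcategory := fun i ↦ ⟨B i, hB i⟩
  let f₀ : ∀ i, X₀ ⟶ E₀ i := fun i ↦ P.homMk (f i)
  let g₀ : ∀ i, E₀ i ⟶ B₀ i := fun i ↦ P.homMk (g i)
  let X₁ : P.FullSubcategory := ⟨X', hX'⟩
  let E₁ : P.FullSubcategory := ⟨E', hE'⟩
  let f₁ : X₁ ⟶ E₁ := P.homMk f'
  let x₀ : I → (X₀ ⟶ X₁) := fun i ↦ P.homMk (x i)
  let e₀ : ∀ i, E₀ i ⟶ E₁ := fun i ↦ P.homMk (e i)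
  -- A coproduct of `D` lying in `P` is also a coproduct in the subcategory. This identifies the
  -- first two terms; nothing of the kind is known in advance for `B`.
  have hx₀ : IsColimit (Cofan.mk _ x₀) := isColimitOfAmbientCofan hx
  have he₀ : IsColimit (Cofan.mk _ e₀) := isColimitOfAmbientCofan he
  have mem₀ : Triangle.mk (Limits.Sigma.map f₀).hom (Limits.Sigma.map g₀).hom (G.Γ B₀ X₀ η) ∈
    distTriang D := G.realizes_Γ (B := B₀) (E := E₀) (A := X₀) η f₀ g₀ mem
  let ex := (coproductIsCoproduct fun _ : I ↦ X₀).coconePointUniqueUpToIso hx₀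
  let ee := (coproductIsCoproduct E₀).coconePointUniqueUpToIso he₀
  have hex (i : I) : Limits.Sigma.ι (fun _ : I ↦ X₀) i ≫ ex.hom = x₀ i :=
    (coproductIsCoproduct fun _ : I ↦ X₀).comp_coconePointUniqueUpToIso_hom hx₀ ⟨i⟩
  have hee (i : I) : Limits.Sigma.ι E₀ i ≫ ee.hom = e₀ i :=
    (coproductIsCoproduct E₀).comp_coconePointUniqueUpToIso_hom he₀ ⟨i⟩
  have comm : Limits.Sigma.map f₀ ≫ ee.hom = ex.hom ≫ f₁ :=
    Limits.Sigma.hom_ext _ _ fun i ↦ by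
      rw [Limits.Sigma.ι_map_assoc, hee, reassoc_of% hex]
      exact InducedCategory.hom_ext (hf i).symm
  -- Isomorphic first maps have isomorphic cones, and the cone on the subcategory side is `∐ B₀`,
  -- which lies in `P`.
  exact P.prop_of_iso (Triangle.π₃.mapIso (isoTriangleOfIso₁₂ _ _ mem₀ mem' (P.ι.mapIso ex)
    (P.ι.mapIso ee) (congrArg InducedCategory.Hom.hom comm))) (∐ B₀).property

/-- If an extension-closed subcategory is AET3.5*, then a product in the ambient category of
cocones `B i` of morphisms `E i ⟶ X` belongs to the subcategory as soon as the products of the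
constant family `X` and of the family `E` do. -/
lemma IsAET35Star.prop_of_isLimit_fan (hP : (ofExtensionClosed P).IsAET35Star.{t}) [Nonempty I]
    {X : D} {E B : I → D} (hX : P X) (hE : ∀ i, P (E i)) (hB : ∀ i, P (B i))
    (f : ∀ i, B i ⟶ E i) (g : ∀ i, E i ⟶ X) (η : ∀ i, X ⟶ (B i)⟦(1 : ℤ)⟧)
    (mem : ∀ i, Triangle.mk (f i) (g i) (η i) ∈ distTriang D)
    {X' E' B' : D} {x : I → (X' ⟶ X)} {e : ∀ i, E' ⟶ E i} {b : ∀ i, B' ⟶ B i}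
    (hx : IsLimit (Fan.mk X' x)) (he : IsLimit (Fan.mk E' e))
    (hb : IsLimit (Fan.mk B' b)) (hX' : P X') (hE' : P E') : P B' := by
  obtain ⟨_, ⟨G⟩⟩ := hP I
  obtain ⟨f', hf⟩ := exists_lift_of_isLimit_fan he fun i ↦ b i ≫ f i
  obtain ⟨g', hg⟩ := exists_lift_of_isLimit_fan hx fun i ↦ e i ≫ g i
  obtain ⟨η', hη⟩ := exists_lift_of_isLimit_fan (isLimitShiftFan hb 1) fun i ↦ x i ≫ η i
  have mem' : Triangle.mk f' g' η' ∈ distTriang D := distinguished_of_isLimit_fan _ mem _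
    (fun i ↦ Triangle.homMk (Triangle.mk f' g' η') _ (b i) (e i) (x i) (hf i) (hg i) (hη i))
      hb he hx
  let X₀ : P.FullSubcategory := ⟨X, hX⟩
  let E₀ : I → P.FullSubcategory := fun i ↦ ⟨E i, hE i⟩
  let B₀ : I → P.FullSubcategory := fun i ↦ ⟨B i, hB i⟩
  let X₁ : P.FullSubcategoryᵒᵖ := .op X₀
  let E₁ : I → P.FullSubcategoryᵒᵖ := fun i ↦ .op (E₀ i)
  let B₁ : I → P.FullSubcategoryᵒᵖ := fun i ↦ .op (B₀ i)
  let f₀ : ∀ i, B₀ i ⟶ E₀ i := fun i ↦ P.homMk (f i)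
  let g₀ : ∀ i, E₀ i ⟶ X₀ := fun i ↦ P.homMk (g i)
  let f₁ : ∀ i, E₁ i ⟶ B₁ i := fun i ↦ (f₀ i).op
  let g₁ : ∀ i, X₁ ⟶ E₁ i := fun i ↦ (g₀ i).op
  let X₂ : P.FullSubcategory := ⟨X', hX'⟩
  let E₂ : P.FullSubcategory := ⟨E', hE'⟩
  let x₀ : I → (X₂ ⟶ X₀) := fun i ↦ P.homMk (x i)
  let e₀ : ∀ i, E₂ ⟶ E₀ i := fun i ↦ P.homMk (e i)
  let x₁ : I → (X₁ ⟶ .op X₂) := fun i ↦ (x₀ i).op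
  let e₁ : ∀ i, E₁ i ⟶ .op E₂ := fun i ↦ (e₀ i).op
  have hx₁ : IsColimit (Cofan.mk _ x₁) := isColimitOpOfAmbientFan hx
  have he₁ : IsColimit (Cofan.mk _ e₁) := isColimitOpOfAmbientFan he
  have mem₁ : Triangle.mk (Limits.Sigma.map f₁).unop.hom (Limits.Sigma.map g₁).unop.hom
    (G.Γ B₁ X₁ η) ∈ distTriang D := G.realizes_Γ (B := B₁) (E := E₁) (A := X₁) η g₁ f₁ mem
  let ex := (coproductIsCoproduct fun _ : I ↦ X₁).coconePointUniqueUpToIso hx₁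
  let ee := (coproductIsCoproduct E₁).coconePointUniqueUpToIso he₁
  have hex (i : I) : Limits.Sigma.ι (fun _ : I ↦ X₁) i ≫ ex.hom = x₁ i :=
    (coproductIsCoproduct fun _ : I ↦ X₁).comp_coconePointUniqueUpToIso_hom hx₁ ⟨i⟩
  have hee (i : I) : Limits.Sigma.ι E₁ i ≫ ee.hom = e₁ i :=
    (coproductIsCoproduct E₁).comp_coconePointUniqueUpToIso_hom he₁ ⟨i⟩
  let g₂ : E₂ ⟶ X₂ := P.homMk g'
  have comm : Limits.Sigma.map g₁ ≫ ee.hom = ex.hom ≫ g₂.op :=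
    Limits.Sigma.hom_ext _ _ fun i ↦ by
      rw [Limits.Sigma.ι_map_assoc, hee, reassoc_of% hex]
      exact Quiver.Hom.unop_inj (InducedCategory.hom_ext (hg i).symm)
  have comm' : g' ≫ ex.hom.unop.hom = ee.hom.unop.hom ≫ (Limits.Sigma.map g₁).unop.hom :=
    (congrArg (fun k ↦ k.unop.hom) comm).symm
  -- Here the last two terms are known. Rotation makes `B'⟦1⟧` the cone to be compared, and full
  -- faithfulness of the shift removes the `⟦1⟧`.
  exact P.prop_of_iso ((shiftFunctor D (1 : ℤ)).preimageIso (Triangle.π₃.mapIso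
    (isoTriangleOfIso₁₂ _ _ (rot_of_distTriang _ mem') (rot_of_distTriang _ mem₁)
      (P.ι.mapIso ee.unop) (P.ι.mapIso ex.unop) comm'))).symm (∐ B₁).unop.property

end

end ExtriangulatedStructure

namespace CategoryTheory.Triangulated.TStructure

open scoped ZeroObject

variable {D : Type u} [Category.{v} D] [Preadditive D] [HasZeroObject D] [HasShift D ℤ]
  [∀ n : ℤ, (shiftFunctor D n).Additive] [Pretriangulated D] (x : TStructure D)

instance containsZero_le (n : ℤ) : (x.le n).ContainsZero :=
  ⟨⟨0, isZero_zero D, (inferInstance : x.IsLE 0 n).le⟩⟩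

instance containsZero_ge (n : ℤ) : (x.ge n).ContainsZero :=
  ⟨⟨0, isZero_zero D, (inferInstance : x.IsGE 0 n).ge⟩⟩

end CategoryTheory.Triangulated.TStructure

/-! ### Recovering closure of the torsion pair from the extended heart -/

namespace TorsionPair

open scoped ZeroObject

open DerivedCategory (singleFunctor)

variable {A : Type u} [Category.{v} A] [Abelian A] [HasDerivedCategory.{w} A] {𝒯 : TorsionPair A}

/-- The aisle kills the torsion-free quotient map of `X` in `𝒟`, hence in `A` by faithfulness, so
the torsion part is all of `X`. -/
lemma tors_of_aisle {X : A} (hX : 𝒯.aisle ((singleFunctor A 0).obj X)) : 𝒯.tors X := by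
  obtain ⟨T, F, i, p, w, hT, hF, h⟩ := 𝒯.exists_shortExact X
  have hp : p = 0 := (singleFunctor A 0).map_injective <| by
    rw [Functor.map_zero]
    refine 𝒯.aisle_hom_eq_zero _ hX ?_
    rw [coaisle_shift]
    exact ObjectProperty.le_extensionProduct_left _ _ (ObjectProperty.prop_map_obj _ _ hF)
  have := h.exact.epi_f hp
  have := h.mono_f
  have := isIso_of_mono_of_epi i
  exact 𝒯.tors.prop_of_iso (asIso i) hT

/-- Dually, the inclusion of the torsion part vanishes, because torsion objects lie in the aisle. -/
lemma free_of_coaisle {X : A} (hX : 𝒯.coaisle (((singleFunctor A 0).obj X)⟦(1 : ℤ)⟧)) :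
    𝒯.free X := by
  obtain ⟨T, F, i, p, w, hT, hF, h⟩ := 𝒯.exists_shortExact X
  have hi : i = 0 := (singleFunctor A 0).map_injective <| by
    rw [Functor.map_zero]
    refine 𝒯.aisle_hom_eq_zero _ ?_ hX
    rw [aisle_eq]
    exact ObjectProperty.le_extensionProduct_right _ _ (ObjectProperty.prop_map_obj _ _ hT)
  have := h.epi_g
  have := h.exact.mono_g hi
  have := isIso_of_mono_of_epi p
  exact 𝒯.free.prop_of_iso (asIso p).symm hF

lemma le_aisle : (DerivedCategory.TStructure.t (C := A)).le (-1) ≤ 𝒯.aisle := fun _ hX ↦ by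
  rw [aisle_eq]
  exact ObjectProperty.le_extensionProduct_left _ _ hX

lemma ge_le_coaisle : (DerivedCategory.TStructure.t (C := A)).ge 0 ≤ 𝒯.coaisle := by
  have : ((𝒯.free.map (singleFunctor A 0)).shift (-1 : ℤ)).ContainsZero :=
    ⟨⟨0, isZero_zero _, (𝒯.free.map (singleFunctor A 0)).prop_of_isZero
      ((shiftFunctor (DerivedCategory A) (-1 : ℤ)).map_isZero (isZero_zero _))⟩⟩
  exact ObjectProperty.le_extensionProduct_right _

/-- The two bounds `le 1` and `ge 0` of the tilt are unfolded so that membership can be tested on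
the aisle and coaisle themselves. -/
lemma extendedHeart_iff (X : DerivedCategory A) :
    𝒯.tilt.extendedHeart X ↔ 𝒯.aisle (X⟦(1 : ℤ)⟧) ∧ 𝒯.coaisle X := by
  rw [TStructure.extendedHeart_eq, tilt_ge_zero]
  exact Iff.rfl

lemma extendedHeart_single (X : A) : 𝒯.tilt.extendedHeart ((singleFunctor A 0).obj X) :=
  (extendedHeart_iff _).2
    ⟨le_aisle _ (DerivedCategory.TStructure.t.le_shift 0 1 (-1) (by lia) _
        (inferInstance : DerivedCategory.IsLE _ 0).le),
      ge_le_coaisle _ (inferInstance : DerivedCategory.IsGE _ 0).ge⟩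

lemma extendedHeart_single_shift {X : A} (hX : 𝒯.free X) :
    𝒯.tilt.extendedHeart (((singleFunctor A 0).obj X)⟦(1 : ℤ)⟧) :=
  (extendedHeart_iff _).2
    ⟨le_aisle _ (DerivedCategory.TStructure.t.le_shift 0 1 (-1) (by lia) _
        (DerivedCategory.TStructure.t.le_monotone (by lia) _
          (DerivedCategory.TStructure.t.le_shift 0 1 (-1) (by lia) _
            (inferInstance : DerivedCategory.IsLE _ 0).le))),
      ObjectProperty.le_extensionProduct_left _ _ ((𝒯.free.map (singleFunctor A 0)).prop_of_iso
        ((shiftEquiv (DerivedCategory A) (1 : ℤ)).unitIso.app _)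
        (ObjectProperty.prop_map_obj _ _ hX))⟩

lemma extendedHeart_single_shift_neg {X : A} (hX : 𝒯.tors X) :
    𝒯.tilt.extendedHeart (((singleFunctor A 0).obj X)⟦(-1 : ℤ)⟧) := by
  refine (extendedHeart_iff _).2 ⟨?_, ge_le_coaisle _
    (DerivedCategory.TStructure.t.ge_antitone (by lia) _
      (DerivedCategory.TStructure.t.ge_shift 0 (-1) 1 (by lia) _
        (inferInstance : DerivedCategory.IsGE _ 0).ge))⟩
  rw [aisle_eq]
  exact ObjectProperty.le_extensionProduct_right _ _ ((𝒯.tors.map (singleFunctor A 0)).prop_of_iso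
    ((shiftEquiv (DerivedCategory A) (1 : ℤ)).counitIso.symm.app _)
    (ObjectProperty.prop_map_obj _ _ hX))

/-- The first term of the extensions must be the same for all `i`. Taking the coproduct `Y` itself,
with the cones of `Y ⟶ cokernel (f i)`, arranges this and makes `ΣY` the coproduct of those cones.
-/
lemma isSmashing_of_isAET35 [HasCoproducts.{t} A] [AB4OfSize.{t} A]
    (h : 𝒯.tilt.extendedHeartExtriangulated.IsAET35.{t}) : 𝒯.IsSmashing.{t} := fun I ↦
  ObjectProperty.isClosedUnderCoproductsOfShape_of_cofan fun X Y f hf hX ↦ by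
    -- AET3.5 says nothing about the empty index set; there the coproduct is zero.
    rcases isEmpty_or_nonempty I with _ | _
    · refine 𝒯.free.prop_of_isZero ?_
      rw [IsZero.iff_id_eq_zero]
      exact hom_ext_of_isColimit_cofan hf isEmptyElim
    · have hf' (i : I) : Mono (f i) := MonoCoprod.mono_inj _ _ hf i
      have hS (i : I) : (ShortComplex.mk (f i) (cokernel.π (f i))
          (cokernel.condition (f i))).ShortExact :=
        .mk' (ShortComplex.exact_cokernel _) inferInstance inferInstance
      have colimit_single {Z : I → A} {W : A} {g : ∀ i, Z i ⟶ W} (hg : IsColimit (Cofan.mk W g)) :=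
        Cofan.isColimitMapCoconeEquiv (singleFunctor A 0) _ _ (isColimitOfPreserves _ hg)
      have key := ExtriangulatedStructure.IsAET35.prop_of_isColimit_cofan h
        (extendedHeart_single Y) (fun i ↦ extendedHeart_single (cokernel (f i)))
        (fun i ↦ extendedHeart_single_shift (hX i)) _ _ _
        -- Rotation moves `X i` to the third place, as `ΣX i`, leaving `Y` and the cokernel as the
        -- first two terms.
        (fun i ↦ rot_of_distTriang _ (hS i).singleTriangle_distinguished)
        (colimit_single (coproductIsCoproduct fun _ : I ↦ Y))
        (colimit_single (coproductIsCoproduct fun i ↦ cokernel (f i)))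
        (isColimitShiftCofan (colimit_single hf) 1)
        (extendedHeart_single _) (extendedHeart_single _)
      exact free_of_coaisle ((extendedHeart_iff _).1 key).2

lemma isCoSmashing_of_isAET35Star [HasProducts.{t} A] [AB4StarOfSize.{t} A]
    (h : 𝒯.tilt.extendedHeartExtriangulated.IsAET35Star.{t}) : 𝒯.IsCoSmashing.{t} := fun I ↦
  ObjectProperty.isClosedUnderProductsOfShape_of_fan fun X Y f hf hX ↦ by
    rcases isEmpty_or_nonempty I with _ | _
    · refine 𝒯.tors.prop_of_isZero ?_
      rw [IsZero.iff_id_eq_zero]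
      exact hom_ext_of_isLimit_fan hf isEmptyElim
    · have hf' (i : I) : Epi (f i) := by
        have : HasProduct X := ⟨⟨_, hf⟩⟩
        have e : (hf.conePointUniqueUpToIso (productIsProduct X)).hom ≫ Limits.Pi.π X i = f i :=
          hf.conePointUniqueUpToIso_hom_comp (productIsProduct X) ⟨i⟩
        exact e ▸ epi_comp _ (Limits.Pi.π X i)
      have hS (i : I) : (ShortComplex.mk (kernel.ι (f i)) (f i)
          (kernel.condition (f i))).ShortExact :=
        .mk' (ShortComplex.exact_kernel _) inferInstance inferInstance
      have limit_single {Z : I → A} {W : A} {g : ∀ i, W ⟶ Z i} (hg : IsLimit (Fan.mk W g)) :=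
        Fan.isLimitMapConeEquiv (singleFunctor A 0) _ _ (isLimitOfPreserves _ hg)
      have key := ExtriangulatedStructure.IsAET35Star.prop_of_isLimit_fan h
        (extendedHeart_single Y) (fun i ↦ extendedHeart_single (kernel (f i)))
        (fun i ↦ extendedHeart_single_shift_neg (hX i)) _ _ _
        -- The inverse rotation puts `Σ⁻¹X i` first, followed by the kernel and by `Y`, the constant
        -- term.
        (fun i ↦ inv_rot_of_distTriang _ (hS i).singleTriangle_distinguished)
        (limit_single (productIsProduct fun _ : I ↦ Y))
        (limit_single (productIsProduct fun i ↦ kernel (f i)))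
        (isLimitShiftFan (limit_single hf) (-1)) (extendedHeart_single _) (extendedHeart_single _)
      -- `key` places `Σ⁻¹Y` in the extended heart, so `ΣΣ⁻¹Y ≅ Y` lies in the aisle.
      exact tors_of_aisle (𝒯.aisle.prop_of_iso
        ((shiftEquiv (DerivedCategory A) (1 : ℤ)).counitIso.app _) ((extendedHeart_iff _).1 key).1)

end TorsionPair

theorem mainTheorem8 {A : Type u} [Category.{v} A] [Abelian A] [HasDerivedCategory.{w} A]
    (𝒯 : TorsionPair A) :
    (∀ [HasCoproducts.{t} A] [AB4OfSize.{t} A], List.TFAE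
      [𝒯.tilt.IsSmashing.{t},
        𝒯.IsSmashing.{t},
        𝒯.tilt.extendedHeartExtriangulated.IsAET4.{t},
        𝒯.tilt.extendedHeartExtriangulated.IsAET35.{t}]) ∧
    (∀ [HasProducts.{t} A] [AB4StarOfSize.{t} A], List.TFAE
      [𝒯.tilt.IsCoSmashing.{t},
        𝒯.IsCoSmashing.{t},
        𝒯.tilt.extendedHeartExtriangulated.IsAET4Star.{t},
        𝒯.tilt.extendedHeartExtriangulated.IsAET35Star.{t}]) := by
  refine ⟨fun {_ _} ↦ ?_, fun {_ _} ↦ ?_⟩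
  · tfae_have 2 → 1 := TorsionPair.IsSmashing.tilt
    tfae_have 1 → 3 := TStructure.IsSmashing.isAET4
    tfae_have 3 → 4 := fun h I _ ↦ (h I).imp fun _ ⟨G, _⟩ ↦ ⟨G⟩
    tfae_have 4 → 2 := TorsionPair.isSmashing_of_isAET35
    tfae_finish
  · tfae_have 2 → 1 := TorsionPair.IsCoSmashing.tilt
    tfae_have 1 → 3 := TStructure.IsCoSmashing.isAET4Star
    tfae_have 3 → 4 := fun h I _ ↦ (h I).imp fun _ ⟨G, _⟩ ↦ ⟨G⟩
    tfae_have 4 → 2 := TorsionPair.isCoSmashing_of_isAET35Star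
    tfae_finish
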